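/- **Setting.** For $\tau\in[1/2,1)$ let $\rho_\tau(z)=\tau z$ for $z\ge 0$ and $\rho_\tau(z)=(\tau-1)z$ for $z<0$, and $\rho_\tau(y)=\sum_i\rho_\tau(y_i)$ for vectors. A matrix $U\in\mathbb R^{n\times d}$ is $(\alpha,\beta)$-conditioned if $\sum_{i,j}|U_{ij}|\le\alpha$ and $\|x\|_\infty\le\beta\|Ux\|_1$ for all $x\in\mathbb R^d$; its condition number is the minimum of $\alpha\beta$ over all such pairs. $\mathrm{nnz}(A)$ is the number of nonzero entries of $A$, and $\log$ is the natural logarithm. **Algorithm.** Input: $A\in\mathbb R^{n\times d}$, an invertible $R\in\mathbb R^{d\times d}$ (given through $R^{-1}$) such that $AR^{-1}$ has condition number $\kappa$ (so $A$ has full column rank $d\ge1$), the number $\kappa$, $\varepsilon\in(0,1/2)$ and $\tau\in[1/2,1)$. Put $\mu=\tau/(1-\tau)$. 1. Let $\Pi_2\in\mathbb R^{d\times r_2}$ have independent standard Cauchy entries, where $r_2=\lceil 15\log(40n)\rceil$. 2. Compute $\Lambda=A(R^{-1}\Pi_2)$. 3. Let $\lambda_i=\mathrm{median}_{j}|\Lambda_{ij}|$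 for $i=1,\dots,n$. 4. Let $s=\mu\,\frac{81\kappa}{\varepsilon^2}\left(d\log\frac{18\mu}{\varepsilon}+\log 80\right)$ and $\hat p_i=\min\{1,\ s\lambda_i/\sum_k\lambda_k\}$. 5. Let $S\in\mathbb R^{n\times n}$ be diagonal with entries that are independent given $\Pi_2$, $S_{ii}=1/\hat p_i$ with probability $\hat p_i$ and $S_{ii}=0$ otherwise. Let $\hat s$ be the number of nonzero rows of $S$ (deleting the zero rows gives the $\hat s\times n$ sampling matrix). **Proposition.** There are absolute constants $C_1,C_2$ and a function $\delta$ with $\delta(N)\to0$ as $N\to\infty$ such that for all such $A,R,\kappa,\varepsilon,\tau$ the following hold. (a) *(Running time.)* In the unit-cost real-number model (arithmetic operations, logarithms, comparisons, access to an entry of the input and drawing a random number cost one step each, and bookkeeping is charged too), $A$ being given in compressed sparse row format, the algorithm, implemented without touching zero rows and with linear-time selection for the medians, outputs (the nonzero entries of) $S$. For all $n\ge2$ and whatever the random numbers are, it takes at most $C_1\,(\mathrm{nnz}(A)+d^2)\log n$ steps, and at most $C_1\,\mathrm{nnz}(A)\log n$ steps if $d^2\le\mathrm{nnz}(A)$.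 (b) *(Distortion.)* With probability at least $0.9$, $(1-\varepsilon)\rho_\tau(Ax)\le\rho_\tau(SAx)\le(1+\varepsilon)\rho_\tau(Ax)$ for all $x\in\mathbb R^d$. (c) *(Sample size.)* Let $N=\mu\kappa d\log(\mu/\varepsilon)/\varepsilon^2$. Then $\hat s\le C_2N$ with probability at least $1-\delta(N)$. -/

import Mathlib

open MeasureTheory ProbabilityTheory Filter Topology

namespace QuantileSampling

/-! ### Loss function, conditioning, number of nonzeros -/

/-- The tilted absolute value `ρ_τ(z)` of a real number. -/
noncomputable def rho (τ z : ℝ) : ℝ := if 0 ≤ z then τ * z else (τ - 1) * z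

/-- The quantile loss `ρ_τ(y) = ∑ i, ρ_τ(y i)` of a vector. -/
noncomputable def quantileLoss {n : ℕ} (τ : ℝ) (y : Fin n → ℝ) : ℝ := ∑ i, rho τ (y i)

/-- `U` is `(α, β)`-conditioned: its entrywise `ℓ1` norm is at most `α`, and
`‖x‖_∞ ≤ β ‖U x‖_1` for all `x` (the norm on `Fin d → ℝ` is the sup norm). -/
def IsConditioned {n d : ℕ} (α β : ℝ) (U : Matrix (Fin n) (Fin d) ℝ) : Prop :=
  ∑ i, ∑ j, |U i j| ≤ α ∧ ∀ x : Fin d → ℝ, ‖x‖ ≤ β * ∑ i, |U.mulVec x i|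

/-- `κ` is the condition number of `U`: the minimum of `α * β` over all `(α, β)` such that `U`
is `(α, β)`-conditioned. (Such a minimum can only exist if `U` has full column rank and at least
one column.) -/
def IsConditionNumber {n d : ℕ} (U : Matrix (Fin n) (Fin d) ℝ) (κ : ℝ) : Prop :=
  IsLeast {c : ℝ | ∃ α β : ℝ, IsConditioned α β U ∧ c = α * β} κ

/-- The number of nonzero entries of `A`. -/
noncomputable def nnz {n d : ℕ} (A : Matrix (Fin n) (Fin d) ℝ) : ℕ :=
  (Finset.univ.filter fun q : Fin n × Fin d => A q.1 q.2 ≠ 0).card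

/-! ### The sampling algorithm, mathematically -/

/-- The number `r₂ = 15 log (40 n)` of Cauchy projections, rounded up to an integer. -/
noncomputable def numProj (n : ℕ) : ℕ := ⌈15 * Real.log (40 * n)⌉₊

/-- The median of `r` reals: the middle order statistic for odd `r`, the average of the two
middle order statistics for even `r`. -/
noncomputable def median {r : ℕ} (f : Fin r → ℝ) : ℝ :=
  let s := (Finset.univ.val.map f).sort
  (s.getD ((r - 1) / 2) 0 + s.getD (r / 2) 0) / 2

/-- The estimate `λ_i = median_l |(A R⁻¹ Π₂)_{il}|` of the `ℓ1` norm of row `i` of `A R⁻¹`. -/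
noncomputable def rowEstimate {n d r : ℕ} (A : Matrix (Fin n) (Fin d) ℝ)
    (R : Matrix (Fin d) (Fin d) ℝ) (G : Matrix (Fin d) (Fin r) ℝ) (i : Fin n) : ℝ :=
  median fun l => |(A * (R⁻¹ * G)) i l|

/-- The desired sampling complexity
`s = τ/(1-τ) * 81 κ/ε² * (d log (τ/(1-τ) * 18/ε) + log 80)`. -/
noncomputable def sampleSize (d : ℕ) (κ ε τ : ℝ) : ℝ :=
  τ / (1 - τ) * (81 * κ / ε ^ 2) *
    (d * Real.log (τ / (1 - τ) * (18 / ε)) + Real.log 80)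

/-- The probability `p̂_i = min {1, s λ_i / ∑ λ}` of keeping row `i`. -/
noncomputable def keepProb {n d r : ℕ} (A : Matrix (Fin n) (Fin d) ℝ)
    (R : Matrix (Fin d) (Fin d) ℝ) (κ ε τ : ℝ) (G : Matrix (Fin d) (Fin r) ℝ) (i : Fin n) : ℝ :=
  min 1 (sampleSize d κ ε τ * (rowEstimate A R G i / ∑ k, rowEstimate A R G k))

/-- The randomness of the algorithm: the entries of the `d × r` matrix `Π₂`, and one uniform
number in `[0, 1]` per row, used to toss the coin of that row. -/
abbrev Seed (n d r : ℕ) : Type := (Fin d → Fin r → ℝ) × (Fin n → unitInterval)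

/-- The law of the randomness: all numbers are independent, the entries of `Π₂` are standard
Cauchy and the other numbers are uniform on `[0, 1]`. -/
noncomputable def seedLaw (n d r : ℕ) : Measure (Seed n d r) :=
  (Measure.pi fun _ => Measure.pi fun _ => cauchyMeasure 0 1).prod (Measure.pi fun _ => volume)

/-- The sampling matrix: diagonal, with `S_ii = 1 / p̂_i` if the uniform number of row `i` is less
than `p̂_i` (an event of probability `p̂_i` given `Π₂`), and `S_ii = 0` otherwise. -/
noncomputable def samplingMatrix {n d r : ℕ} (A : Matrix (Fin n) (Fin d) ℝ)
    (R : Matrix (Fin d) (Fin d) ℝ) (κ ε τ : ℝ) (ω : Seed n d r) : Matrix (Fin n) (Fin n) ℝ :=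
  Matrix.diagonal fun i =>
    if (ω.2 i : ℝ) < keepProb A R κ ε τ (Matrix.of ω.1) i
      then 1 / keepProb A R κ ε τ (Matrix.of ω.1) i else 0

/-- The number `ŝ` of sampled rows, i.e. of rows of `S` that are not zero. -/
noncomputable def numSampled {n : ℕ} (S : Matrix (Fin n) (Fin n) ℝ) : ℕ :=
  (Finset.univ.filter fun i => S i i ≠ 0).card

/-- `S` satisfies `(1 - ε) ρ_τ(Ax) ≤ ρ_τ(SAx) ≤ (1 + ε) ρ_τ(Ax)` for all `x`. -/
def IsDistortionEmbedding {n d : ℕ} (ε τ : ℝ) (A : Matrix (Fin n) (Fin d) ℝ)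
    (S : Matrix (Fin n) (Fin n) ℝ) : Prop :=
  ∀ x : Fin d → ℝ,
    (1 - ε) * quantileLoss τ (A.mulVec x) ≤ quantileLoss τ ((S * A).mulVec x) ∧
    quantileLoss τ ((S * A).mulVec x) ≤ (1 + ε) * quantileLoss τ (A.mulVec x)

/-! ### Step-counted real-number computations

A computation of type `Comp ι V α` returns an `α`. It has an input memory with cells addressed by
`ι`, holding numbers of a type `V` about which it knows nothing: programs below are written for
an arbitrary `V` without any operations, so that the only thing they can do with numbers is to use
the following instructions. Every instruction costs one step; the bookkeeping (loops, list and
array handling) is charged by explicit `tick` instructions. -/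

/-- The arithmetic operations. -/
inductive ArithOp : Type
  | add | sub | mul | div

/-- Computations in the real-number machine model. -/
inductive Comp (ι V α : Type) : Type
  /-- stop and return `a` -/
  | ret (a : α) : Comp ι V α
  /-- spend `m` steps on bookkeeping -/
  | tick (m : ℕ) (next : Comp ι V α) : Comp ι V α
  /-- read an input cell (or a random number) -/
  | read (c : ι) (next : V → Comp ι V α) : Comp ι V α
  /-- load an integer constant -/
  | const (m : ℕ) (next : V → Comp ι V α) : Comp ι V α
  /-- an arithmetic operation -/
  | arith (o : ArithOp) (x y : V) (next : V → Comp ι V α) : Comp ι V α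
  /-- a natural logarithm -/
  | log (x : V) (next : V → Comp ι V α) : Comp ι V α
  /-- a comparison `x < y` -/
  | less (x y : V) (next : Bool → Comp ι V α) : Comp ι V α

/-- Real arithmetic. -/
noncomputable def ArithOp.eval : ArithOp → ℝ → ℝ → ℝ
  | .add, x, y => x + y
  | .sub, x, y => x - y
  | .mul, x, y => x * y
  | .div, x, y => x / y

namespace Comp

/-- Execution over the reals, with input memory `mem`: the result and the number of steps. -/
noncomputable def run {ι α : Type} (mem : ι → ℝ) : Comp ι ℝ α → α × ℕ
  | ret a => (a, 0)
  | tick m next => ((run mem next).1, (run mem next).2 + m)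
  | read c next => ((run mem (next (mem c))).1, (run mem (next (mem c))).2 + 1)
  | const m next => ((run mem (next m)).1, (run mem (next m)).2 + 1)
  | arith o x y next =>
      ((run mem (next (o.eval x y))).1, (run mem (next (o.eval x y))).2 + 1)
  | log x next => ((run mem (next (Real.log x))).1, (run mem (next (Real.log x))).2 + 1)
  | less x y next =>
      ((run mem (next (decide (x < y)))).1, (run mem (next (decide (x < y)))).2 + 1)

/-- Sequential composition. -/
def bind {ι V α β : Type} : Comp ι V α → (α → Comp ι V β) → Comp ι V β
  | ret a, f => f a
  | tick m next, f => tick m (bind next f)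
  | read c next, f => read c fun v => bind (next v) f
  | const m next, f => const m fun v => bind (next v) f
  | arith o x y next, f => arith o x y fun v => bind (next v) f
  | log x next, f => log x fun v => bind (next v) f
  | less x y next, f => less x y fun b => bind (next b) f

instance {ι V : Type} : Monad (Comp ι V) where
  pure := ret
  bind := bind

end Comp

section Programs

variable {ι V : Type}

/-- Spend `m` steps. -/
def charge (m : ℕ) : Comp ι V Unit := .tick m (.ret ())

/-- Read the cell `c`. -/
def readCell (c : ι) : Comp ι V V := .read c .ret

/-- The integer constant `m`. -/
def constant (m : ℕ) : Comp ι V V := .const m .ret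

/-- `x + y` -/
def plus (x y : V) : Comp ι V V := .arith .add x y .ret

/-- `x - y` -/
def minus (x y : V) : Comp ι V V := .arith .sub x y .ret

/-- `x * y` -/
def times (x y : V) : Comp ι V V := .arith .mul x y .ret

/-- `x / y` -/
def quotient (x y : V) : Comp ι V V := .arith .div x y .ret

/-- `log x` -/
def logarithm (x : V) : Comp ι V V := .log x .ret

/-- `x < y` -/
def isLess (x y : V) : Comp ι V Bool := .less x y .ret

/-- `|x|` -/
def absValue (x : V) : Comp ι V V := do
  let z ← constant 0
  let b ← isLess x z
  if b then minus z x else pure x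

/-- `min 1 x` -/
def minOne (x : V) : Comp ι V V := do
  let o ← constant 1
  let b ← isLess x o
  if b then pure x else pure o

/-- Fill an array of length `n`, whose `i`-th entry is computed by `f i`. -/
def tabulate {α : Type} : (n : ℕ) → (Fin n → Comp ι V α) → Comp ι V (Fin n → α)
  | 0, _ => do
      charge 1
      pure Fin.elim0
  | n + 1, f => do
      charge 1
      let a ← f 0
      let t ← tabulate n fun i => f i.succ
      pure (Fin.cons a t)

/-- Execute `f` on each element of a list, and list the results. -/
def forEach {α β : Type} (f : α → Comp ι V β) : List α → Comp ι V (List β)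
  | [] => do
      charge 1
      pure []
  | a :: l => do
      charge 1
      let b ← f a
      let t ← forEach f l
      pure (b :: t)

/-- The sum of the numbers computed by `f` on the elements of a list. -/
def sumOver {α : Type} (f : α → Comp ι V V) : List α → Comp ι V V
  | [] => constant 0
  | a :: l => do
      charge 1
      let x ← f a
      let y ← sumOver f l
      plus x y

/-- Insert `x` into a sorted list. -/
def insertSorted (x : V) : List V → Comp ι V (List V)
  | [] => do
      charge 1
      pure [x]
  | y :: l => do
      charge 1
      let b ← isLess y x
      if b then do
        let t ← insertSorted x l
        pure (y :: t)
      else pure (x :: y :: l)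

/-- Insertion sort, only used on lists of bounded length. -/
def insertionSort : List V → Comp ι V (List V)
  | [] => do
      charge 1
      pure []
  | x :: l => do
      charge 1
      let t ← insertionSort l
      insertSorted x t

/-- The medians of consecutive groups of five elements (an incomplete last group is dropped). -/
def groupMedians : List V → Comp ι V (List V)
  | a :: b :: c :: e :: f :: l => do
      charge 1
      let g ← insertionSort [a, b, c, e, f]
      let t ← groupMedians l
      pure (g.getD 2 a :: t)
  | _ => do
      charge 1
      pure []

/-- Split a list into the list of the elements less than `p`, the number of the elements equal to
`p`, and the list of the elements greater than `p`. -/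
def splitAt (p : V) : List V → Comp ι V (List V × ℕ × List V)
  | [] => do
      charge 1
      pure ([], 0, [])
  | x :: l => do
      charge 1
      let t ← splitAt p l
      let b ← isLess x p
      if b then pure (x :: t.1, t.2.1, t.2.2)
      else do
        let b' ← isLess p x
        if b' then pure (t.1, t.2.1, x :: t.2.2)
        else pure (t.1, t.2.1 + 1, t.2.2)

/-- The `k`-th smallest element (counted from `0`) of a list, by selection with the median of the
medians of groups of five as pivot. The first argument bounds the depth of the recursion (the length
of the list plus one suffices), and `z` is returned in exceptional cases. -/
def select (z : V) : ℕ → List V → ℕ → Comp ι V V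
  | 0, _, _ => pure z
  | fuel + 1, xs, k => do
      charge (xs.length + 1)
      if xs.length ≤ 100 then do
        let g ← insertionSort xs
        charge (g.length + 1)
        pure (g.getD k z)
      else do
        let ms ← groupMedians xs
        charge (ms.length + 1)
        let p ← select z fuel ms (ms.length / 2)
        let t ← splitAt p xs
        charge (t.1.length + 1)
        if k < t.1.length then select z fuel t.1 k
        else if k < t.1.length + t.2.1 then pure p
        else select z fuel t.2.2 (k - t.1.length - t.2.1)

/-- The median of the numbers in an array. -/
def medianProg {r : ℕ} (t : Fin r → V) : Comp ι V V := do
  charge (r + 1)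
  let z ← constant 0
  let a ← select z (r + 1) (List.ofFn t) ((r - 1) / 2)
  let b ← select z (r + 1) (List.ofFn t) (r / 2)
  let s ← plus a b
  let two ← constant 2
  quotient s two

end Programs

/-- The cells of the input memory of the sampling algorithm: the entries of `A`, of `R⁻¹` and of
the random matrix `Π₂`, the uniform random numbers, and the parameters. -/
inductive Cell (n d r : ℕ) : Type
  | entry (i : Fin n) (j : Fin d)
  | inv (j k : Fin d)
  | cauchy (k : Fin d) (l : Fin r)
  | coin (i : Fin n)
  | kappa
  | eps
  | tau

/-- The contents of the input memory. -/
noncomputable def memory {n d r : ℕ} (A : Matrix (Fin n) (Fin d) ℝ) (R : Matrix (Fin d) (Fin d) ℝ)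
    (κ ε τ : ℝ) (ω : Seed n d r) : Cell n d r → ℝ
  | .entry i j => A i j
  | .inv j k => R⁻¹ j k
  | .cauchy k l => ω.1 k l
  | .coin i => (ω.2 i : ℝ)
  | .kappa => κ
  | .eps => ε
  | .tau => τ

/-- The sparsity pattern of `A` in compressed row form: the nonzero rows, in order, each with the
column indices of its nonzero entries. -/
noncomputable def sparsityPattern {n d : ℕ} (A : Matrix (Fin n) (Fin d) ℝ) :
    List (Fin n × List (Fin d)) :=
  ((List.finRange n).map fun i => (i, (List.finRange d).filter fun j => A i j ≠ 0)).filter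
    fun q => q.2 ≠ []

section Algorithm

variable {V : Type} {n d r : ℕ}

/-- Compute the desired sampling complexity. -/
def sampleSizeProg : Comp (Cell n d r) V V := do
  let κ ← readCell .kappa
  let ε ← readCell .eps
  let τ ← readCell .tau
  let one ← constant 1
  let c ← minus one τ
  let μ ← quotient τ c
  let c81 ← constant 81
  let a ← times c81 κ
  let e2 ← times ε ε
  let q ← quotient a e2
  let m ← times μ q
  let c18 ← constant 18
  let w ← quotient c18 ε
  let v ← times μ w
  let lv ← logarithm v
  let dd ← constant d
  let t ← times dd lv
  let c80 ← constant 80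
  let l80 ← logarithm c80
  let b ← plus t l80
  times m b

/-- The sampling algorithm, for a matrix `A` with sparsity pattern `rows`. It returns the selected
rows `i` with the diagonal entries `S_ii`. Rows of `A` that are zero are not touched. -/
def samplingProg (rows : List (Fin n × List (Fin d))) :
    Comp (Cell n d r) V (List (Fin n × V)) := do
  -- draw the random matrix
  let P ← tabulate d fun k => tabulate r fun l => readCell (.cauchy k l)
  -- multiply it by the inverse of `R`
  let G ← tabulate d fun j => tabulate r fun l =>
    sumOver (fun k => do
      let x ← readCell (.inv j k)
      times x (P k l)) (List.finRange d)
  -- multiply by `A`, row by row, and take medians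
  let est ← forEach (fun q => do
    let row ← tabulate r fun l => do
      let x ← sumOver (fun j => do
        let a ← readCell (.entry q.1 j)
        times a (G j l)) q.2
      absValue x
    let m ← medianProg row
    pure (q.1, m)) rows
  -- compute the probabilities
  let total ← sumOver (fun e => pure e.2) est
  let s ← sampleSizeProg
  let prob ← forEach (fun e => do
    let x ← quotient e.2 total
    let y ← times s x
    let p ← minOne y
    pure (e.1, p)) est
  -- toss the coins
  let out ← forEach (fun e => do
    let u ← readCell (.coin e.1)
    let b ← isLess u e.2
    if b then do
      let one ← constant 1
      let w ← quotient one e.2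
      pure [(e.1, w)]
    else pure []) prob
  charge (out.length + 1)
  pure out.flatten

end Algorithm

/-- The list of the nonzero diagonal entries of `S`, with their positions. -/
noncomputable def diagonalList {n : ℕ} (S : Matrix (Fin n) (Fin n) ℝ) : List (Fin n × ℝ) :=
  ((List.finRange n).filter fun i => S i i ≠ 0).map fun i => (i, S i i)

/-- Execution of the sampling algorithm on `A`, given `R⁻¹`, the parameters and the random numbers:
the output and the number of steps. -/
noncomputable def execute {n d r : ℕ} (A : Matrix (Fin n) (Fin d) ℝ) (R : Matrix (Fin d) (Fin d) ℝ)
    (κ ε τ : ℝ) (ω : Seed n d r) : List (Fin n × ℝ) × ℕ :=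
  (samplingProg (sparsityPattern A)).run (memory A R κ ε τ ω)

end QuantileSampling

/-!
A linear combination of independent standard Cauchy variables is distributed as `‖·‖₁` times one
such variable: the Cauchy law has characteristic function `exp (-|t|)`, by Fourier inversion. So
every `Λᵢⱼ` is a Cauchy multiple of the `ℓ1` norm of the `i`-th row of `A R⁻¹`, and the Chernoff
bound makes all the medians `λᵢ` accurate up to a constant factor with probability at least
`19 / 20`. When they are, conditioning bounds the share of row `i` in `ρ_τ(Ax)` by a small multiple
of `p̂ᵢ`, uniformly in `x`. A Bernstein inequality for the sampled sum then controls `ρ_τ(SAx)` for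
one `x`; a net of the unit `ℓ1` sphere of the column space and the sublinearity of `ρ_τ` extend the
bound to all `x`. As `∑ᵢ p̂ᵢ ≤ s`, the sample size has an exponential tail above a multiple of `s`.
Zero rows have `λᵢ = 0` and are never kept, so they need not be touched.
-/

namespace QuantileSampling

/-! ### Specifications of step-counted programs -/

section Programs

variable {ι α β : Type} {mem : ι → ℝ}

@[simp] theorem run_bind (x : Comp ι ℝ α) (f : α → Comp ι ℝ β) :
    (x >>= f).run mem =
      (((f (x.run mem).1).run mem).1, (x.run mem).2 + ((f (x.run mem).1).run mem).2) := by
  change (Comp.bind x f).run mem = _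
  induction x <;> simp_all only [Comp.bind, Comp.run, zero_add, add_right_comm]

@[simp] theorem run_pure (a : α) : (pure a : Comp ι ℝ α).run mem = (a, 0) := rfl

@[simp] theorem run_charge (m : ℕ) : (charge m : Comp ι ℝ Unit).run mem = ((), m) := by
  simp only [charge, Comp.run, zero_add]

@[simp] theorem run_readCell (c : ι) : (readCell c).run mem = (mem c, 1) := rfl

@[simp] theorem run_constant (m : ℕ) : (constant m : Comp ι ℝ ℝ).run mem = ((m : ℝ), 1) := rfl

@[simp] theorem run_plus (x y : ℝ) : (plus x y).run mem = (x + y, 1) := rfl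

@[simp] theorem run_minus (x y : ℝ) : (minus x y).run mem = (x - y, 1) := rfl

@[simp] theorem run_times (x y : ℝ) : (times x y).run mem = (x * y, 1) := rfl

@[simp] theorem run_quotient (x y : ℝ) : (quotient x y).run mem = (x / y, 1) := rfl

@[simp] theorem run_logarithm (x : ℝ) : (logarithm x).run mem = (Real.log x, 1) := rfl

@[simp] theorem run_isLess (x y : ℝ) : (isLess x y).run mem = (decide (x < y), 1) := rfl

/-- Specification of a program: with input memory `mem`, the result of `x` satisfies `P`, and is
computed in at most `c` steps. A deterministic result `a` is specified by `P := (· = a)`. -/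
def Comp.Ensures (mem : ι → ℝ) (x : Comp ι ℝ α) (c : ℕ) (P : α → Prop) : Prop :=
  P (x.run mem).1 ∧ (x.run mem).2 ≤ c

open QuantileSampling.Comp

theorem Comp.Ensures.mono {x : Comp ι ℝ α} {c c' : ℕ} {P Q : α → Prop} (hx : x.Ensures mem c P)
    (hc : c ≤ c') (hPQ : ∀ a, P a → Q a) : x.Ensures mem c' Q :=
  ⟨hPQ _ hx.1, hx.2.trans hc⟩

theorem Comp.Ensures.mono_cost {x : Comp ι ℝ α} {c c' : ℕ} {P : α → Prop}
    (hx : x.Ensures mem c P) (hc : c ≤ c') : x.Ensures mem c' P :=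
  hx.mono hc fun _ => id

theorem Comp.Ensures.bind {x : Comp ι ℝ α} {f : α → Comp ι ℝ β} {c c' : ℕ} {P : α → Prop}
    {Q : β → Prop} (hx : x.Ensures mem c P) (hf : ∀ a, P a → (f a).Ensures mem c' Q) :
    (x >>= f).Ensures mem (c + c') Q := by
  obtain ⟨hQ, hc'⟩ := hf _ hx.1
  simpa only [Ensures, run_bind] using ⟨hQ, Nat.add_le_add hx.2 hc'⟩

theorem Comp.Ensures.bind_eq {x : Comp ι ℝ α} {f : α → Comp ι ℝ β} {c c' : ℕ} {a : α}
    {Q : β → Prop} (hx : x.Ensures mem c (· = a)) (hf : (f a).Ensures mem c' Q) :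
    (x >>= f).Ensures mem (c + c') Q :=
  hx.bind fun _ h => h ▸ hf

theorem ensures_pure {P : α → Prop} {a : α} (h : P a) :
    (pure a : Comp ι ℝ α).Ensures mem 0 P :=
  ⟨h, le_rfl⟩

theorem ensures_charge (m : ℕ) : (charge m : Comp ι ℝ Unit).Ensures mem m (· = ()) :=
  ⟨rfl, (congrArg Prod.snd (run_charge m)).le⟩

theorem ensures_absValue (x : ℝ) : (absValue x).Ensures mem 3 (· = |x|) := by
  by_cases h : x < 0
  · simp [Ensures, absValue, h, abs_of_neg h]
  · simp [Ensures, absValue, h, abs_of_nonneg (not_lt.1 h)]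

theorem ensures_minOne (x : ℝ) : (minOne x).Ensures mem 2 (· = min 1 x) := by
  by_cases h : x < 1
  · simp [Ensures, minOne, h, h.le]
  · simp [Ensures, minOne, h, not_lt.1 h]

theorem ensures_tabulate {c : ℕ} : ∀ {n : ℕ} {f : Fin n → Comp ι ℝ α} {g : Fin n → α},
    (∀ i, (f i).Ensures mem c (· = g i)) →
      (tabulate n f).Ensures mem (n * (c + 1) + 1) (· = g)
  | 0, _, _, _ => ⟨Subsingleton.elim _ _, by simp [tabulate]⟩
  | n + 1, f, g, h =>
    Ensures.mono_cost ((ensures_charge 1).bind_eq <| (h 0).bind_eq <|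
        (ensures_tabulate fun i => h i.succ).bind_eq <|
          ensures_pure (Fin.cons_self_tail g))
      (by simp only [Nat.add_mul]; omega)

theorem ensures_forEach {f : α → Comp ι ℝ β} {g : α → β} {c : α → ℕ} : ∀ {l : List α},
    (∀ a ∈ l, (f a).Ensures mem (c a) (· = g a)) →
      (forEach f l).Ensures mem ((l.map fun a => c a + 1).sum + 1) (· = l.map g)
  | [], _ => by simp [Ensures, forEach]
  | a :: l, h =>
    Ensures.mono_cost ((ensures_charge 1).bind_eq <| (h a List.mem_cons_self).bind_eq <|
        (ensures_forEach fun b hb => h b (List.mem_cons_of_mem a hb)).bind_eq <|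
          ensures_pure List.map_cons.symm)
      (by simp only [List.map_cons, List.sum_cons]; omega)

theorem ensures_sumOver {f : α → Comp ι ℝ ℝ} {g : α → ℝ} {c : ℕ} : ∀ {l : List α},
    (∀ a ∈ l, (f a).Ensures mem c (· = g a)) →
      (sumOver f l).Ensures mem (l.length * (c + 2) + 1) (· = (l.map g).sum)
  | [], _ => by simp [Ensures, sumOver]
  | a :: l, h =>
    Ensures.mono_cost ((ensures_charge 1).bind_eq <| (h a List.mem_cons_self).bind_eq <|
        (ensures_sumOver fun b hb => h b (List.mem_cons_of_mem a hb)).bind_eq <|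
          (show (plus _ _).Ensures mem 1 (· = _) from
            ⟨(List.sum_cons ..).symm, le_rfl⟩))
      (by simp only [List.length_cons, Nat.add_mul]; omega)

theorem ensures_insertSorted (x : ℝ) : ∀ l : List ℝ,
    (insertSorted x l).Ensures mem (2 * l.length + 1) (· = l.orderedInsert (· ≤ ·) x)
  | [] => by simp [Ensures, insertSorted]
  | y :: l => by
      obtain ⟨heq, hle⟩ := ensures_insertSorted x l
      rcases le_or_gt x y with h | h
      · simp [Ensures, insertSorted, h, not_lt.2 h]
        omega
      · simp [Ensures, insertSorted, h, not_le.2 h, heq]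
        omega

theorem ensures_insertionSort : ∀ l : List ℝ,
    (insertionSort l).Ensures mem (l.length * (2 * l.length + 2) + 1)
      (· = l.insertionSort (· ≤ ·))
  | [] => by simp [Ensures, insertionSort]
  | x :: l =>
    Ensures.mono_cost ((ensures_charge 1).bind_eq <| (ensures_insertionSort l).bind_eq <|
        ensures_insertSorted x _)
      (by rw [List.length_insertionSort, List.length_cons]; nlinarith)

theorem ensures_splitAt (p : ℝ) : ∀ l : List ℝ,
    (splitAt p l).Ensures mem (3 * l.length + 1)
      (· = (l.filter (· < p), l.countP (· = p), l.filter (p < ·)))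
  | [] => by simp [Ensures, splitAt]
  | x :: l => by
      obtain ⟨heq, hle⟩ := ensures_splitAt p l
      rcases lt_trichotomy x p with h | h | h
      · simp [Ensures, splitAt, heq, h, h.not_gt, h.ne]
        omega
      · simp [Ensures, splitAt, heq, h]
        omega
      · simp [Ensures, splitAt, heq, h, h.not_gt, h.ne']
        omega

end Programs

/-! ### Order statistics -/

section OrderStatistics

theorem countP_mono {α : Type*} {p q : α → Prop} [DecidablePred p] [DecidablePred q]
    (h : ∀ x, p x → q x) (l : List α) : l.countP (p ·) ≤ l.countP (q ·) :=
  List.countP_mono_left fun x _ hx => by simpa using h x (by simpa using hx)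

variable {α : Type*} [LinearOrder α]

/-- `x` is the `k`-th smallest element (counted from `0`) of the list `xs`. -/
def IsKth (xs : List α) (k : ℕ) (x : α) : Prop :=
  xs.countP (· < x) ≤ k ∧ k < xs.countP (· ≤ x)

theorem countP_le_eq_countP_lt_add_countP_eq (p : α) (l : List α) :
    l.countP (· ≤ p) = l.countP (· < p) + l.countP (· = p) := by
  induction l with
  | nil => rfl
  | cons x l ih =>
    rcases lt_trichotomy x p with h | h | h
    · simp [ih, h, h.ne, h.le, add_right_comm]
    · simp [ih, h, add_assoc]
    · simp [ih, h.not_ge, h.ne', h.not_gt]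

theorem length_eq_countP_le_add_countP_gt (p : α) (l : List α) :
    l.length = l.countP (· ≤ p) + l.countP (p < ·) := by
  simpa only [decide_eq_true_eq, not_le] using
    List.length_eq_countP_add_countP (fun x => decide (x ≤ p)) (l := l)

theorem length_eq_countP_lt_add_countP_ge (p : α) (l : List α) :
    l.length = l.countP (· < p) + l.countP (p ≤ ·) := by
  simpa only [decide_eq_true_eq, not_lt] using
    List.length_eq_countP_add_countP (fun x => decide (x < p)) (l := l)

namespace IsKth

variable {xs ys : List α} {k l : ℕ} {x y p : α}

theorem lt_iff (hx : IsKth xs k x) : x < y ↔ k < xs.countP (· < y) :=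
  ⟨fun h => hx.2.trans_le (countP_mono (fun _ hz => hz.trans_lt h) xs), fun h => by
    by_contra! hle
    exact (h.trans_le (countP_mono (fun _ hz => hz.trans_le hle) xs)).not_ge hx.1⟩

theorem le_of_le (hx : IsKth xs k x) (hy : IsKth xs l y) (hkl : k ≤ l) : x ≤ y := by
  by_contra! h
  exact ((hy.lt_iff.1 h).trans_le hx.1).not_ge hkl

theorem unique (hx : IsKth xs k x) (hy : IsKth xs k y) : x = y :=
  (hx.le_of_le hy le_rfl).antisymm (hy.le_of_le hx le_rfl)

theorem perm (h : xs.Perm ys) (hx : IsKth xs k x) : IsKth ys k x :=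
  ⟨h.countP_eq _ ▸ hx.1, h.countP_eq _ ▸ hx.2⟩

theorem mem (hx : IsKth xs k x) : x ∈ xs := by
  have hpos : 0 < xs.countP (· = x) := by
    have := countP_le_eq_countP_lt_add_countP_eq x xs
    have := hx.1
    have := hx.2
    omega
  obtain ⟨a, ha, hax⟩ := List.countP_pos_iff.1 hpos
  exact of_decide_eq_true hax ▸ ha

theorem map {β : Type*} [LinearOrder β] {g : α → β} (hg : Monotone g) (hx : IsKth xs k x) :
    IsKth (xs.map g) k (g x) := by
  rw [IsKth, List.countP_map, List.countP_map]
  exact ⟨(countP_mono (fun _ hz => hg.reflect_lt hz) xs).trans hx.1,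
    hx.2.trans_le (countP_mono (fun _ hz => hg hz) xs)⟩

theorem of_filter_lt (h : IsKth (xs.filter (· < p)) k x) : IsKth xs k x := by
  have hxp : x < p := of_decide_eq_true (List.mem_filter.1 h.mem).2
  obtain ⟨hlt, hle⟩ := h
  rw [List.countP_filter] at hlt hle
  simp only [← Bool.decide_and] at hlt hle
  exact ⟨(countP_mono (fun _ hz => ⟨hz, hz.trans hxp⟩) xs).trans hlt,
    hle.trans_le (countP_mono (fun _ hz => hz.1) xs)⟩

theorem of_filter_gt (hk : xs.countP (· ≤ p) ≤ k)
    (h : IsKth (xs.filter (p < ·)) (k - xs.countP (· ≤ p)) x) : IsKth xs k x := by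
  have hpx : p < x := of_decide_eq_true (List.mem_filter.1 h.mem).2
  have countP_eq_add (q : α → Bool) (hq : ∀ y ≤ p, q y) (l : List α) :
      l.countP q = l.countP (· ≤ p) + (l.filter (p < ·)).countP q := by
    induction l with
    | nil => rfl
    | cons y l ih =>
      rcases le_or_gt y p with hy | hy
      · simp [ih, hy, hq y hy, hy.not_gt, add_right_comm]
      · simp [ih, hy, hy.not_ge, List.countP_cons, add_assoc]
  obtain ⟨hlt, hle⟩ := h
  constructor
  · rw [countP_eq_add _ fun y hy => by simpa using hy.trans_lt hpx]
    omega
  · rw [countP_eq_add _ fun y hy => by simpa using hy.trans hpx.le]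
    omega

end IsKth

theorem isKth_append_cons {l₁ l₂ : List α} {a : α} (h : (l₁ ++ a :: l₂).Pairwise (· ≤ ·)) :
    IsKth (l₁ ++ a :: l₂) l₁.length a := by
  obtain ⟨-, hr, hl⟩ := List.pairwise_append.1 h
  have hlt : l₂.countP (· < a) = 0 :=
    List.countP_eq_zero.2 fun b hb => by simpa using List.rel_of_pairwise_cons hr hb
  have hle : l₁.countP (· ≤ a) = l₁.length :=
    List.countP_eq_length.2 fun b hb => by simpa using hl b hb a List.mem_cons_self
  constructor
  · simpa [List.countP_append, hlt] using List.countP_le_length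
  · simp [List.countP_append, hle]

theorem isKth_getD_of_pairwise {l : List α} (hl : l.Pairwise (· ≤ ·)) {k : ℕ} (hk : k < l.length)
    (z : α) : IsKth l k (l.getD k z) := by
  rw [List.getD_eq_getElem _ _ hk]
  have hsplit : l = l.take k ++ l[k] :: l.drop (k + 1) := by
    rw [← List.drop_eq_getElem_cons, List.take_append_drop]
  have := isKth_append_cons (hsplit ▸ hl)
  rwa [← hsplit, List.length_take, min_eq_left hk.le] at this

theorem isKth_getD_insertionSort {l : List α} {k : ℕ} (hk : k < l.length) (z : α) :
    IsKth l k ((l.insertionSort (· ≤ ·)).getD k z) :=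
  (isKth_getD_of_pairwise (List.pairwise_insertionSort _ l) (by simpa using hk) z).perm
    (List.perm_insertionSort _ l)

theorem isKth_getD_sort_map {r : ℕ} (f : Fin r → α) {k : ℕ} (hk : k < r) (z : α) :
    IsKth (List.ofFn f) k ((Finset.univ.val.map f).sort.getD k z) := by
  refine (isKth_getD_of_pairwise (Multiset.pairwise_sort _ (· ≤ ·)) (by simpa using hk) z).perm ?_
  rw [← Multiset.coe_eq_coe, Multiset.sort_eq, Fin.univ_val_map]

/-- The property of the medians `ms` of the groups of five of a list `l` that makes their median a
good pivot for `l`. -/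
structure IsGroupMedians (l ms : List α) : Prop where
  length_eq : ms.length = l.length / 5
  three_mul_countP_le (p : α) : 3 * ms.countP (· ≤ p) ≤ l.countP (· ≤ p)
  three_mul_countP_ge (p : α) : 3 * ms.countP (p ≤ ·) ≤ l.countP (p ≤ ·)

namespace IsGroupMedians

variable {g l ms : List α} {m p : α}

theorem of_length_lt (h : l.length < 5) : IsGroupMedians l [] where
  length_eq := (Nat.div_eq_of_lt h).symm
  three_mul_countP_le _ := Nat.zero_le _
  three_mul_countP_ge _ := Nat.zero_le _

theorem append (hg : g.length = 5) (hm : IsKth g 2 m) (h : IsGroupMedians l ms) :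
    IsGroupMedians (g ++ l) (m :: ms) where
  length_eq := by
    rw [List.length_cons, List.length_append, h.length_eq, hg]
    omega
  three_mul_countP_le p := by
    have hms := h.three_mul_countP_le p
    rw [List.countP_append, List.countP_cons]
    split_ifs with hmp
    · have := hm.2.trans_le (countP_mono (fun _ hx => hx.trans (of_decide_eq_true hmp)) g)
      omega
    · omega
  three_mul_countP_ge p := by
    have hms := h.three_mul_countP_ge p
    rw [List.countP_append, List.countP_cons]
    split_ifs with hpm
    · have := countP_mono (fun _ hx => (of_decide_eq_true hpm).trans hx : ∀ x, m ≤ x → p ≤ x) g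
      have := length_eq_countP_lt_add_countP_ge m g
      have := hm.1
      omega
    · omega

theorem ten_mul_countP_lt_le (h : IsGroupMedians l ms) (hp : IsKth ms (ms.length / 2) p) :
    10 * l.countP (· < p) ≤ 7 * l.length + 12 := by
  have := h.length_eq
  have := h.three_mul_countP_ge p
  have := length_eq_countP_lt_add_countP_ge p ms
  have := length_eq_countP_lt_add_countP_ge p l
  have := hp.1
  omega

theorem ten_mul_countP_gt_le (h : IsGroupMedians l ms) (hp : IsKth ms (ms.length / 2) p) :
    10 * l.countP (p < ·) ≤ 7 * l.length := by
  have := h.length_eq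
  have := h.three_mul_countP_le p
  have := length_eq_countP_le_add_countP_gt p l
  have := hp.2
  omega

end IsGroupMedians

end OrderStatistics

/-! ### Linear-time selection -/

section Selection

variable {ι : Type} {mem : ι → ℝ}

open QuantileSampling.Comp

theorem ensures_groupMedians : ∀ l : List ℝ,
    (groupMedians l).Ensures mem (13 * l.length + 1) (IsGroupMedians l)
  | a :: b :: c :: e :: f :: l => by
      rw [groupMedians]
      exact Ensures.mono_cost ((ensures_charge 1).bind_eq <|
        (ensures_insertionSort [a, b, c, e, f]).bind_eq <|
          (ensures_groupMedians l).bind fun _ hms => ensures_pure <|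
            hms.append (g := [a, b, c, e, f]) rfl (isKth_getD_insertionSort (by simp) a))
        (by simp only [List.length_cons, List.length_nil]; omega)
  | [] | [_] | [_, _] | [_, _, _] | [_, _, _, _] => by
      constructor
      · exact .of_length_lt (by simp)
      · simp [groupMedians]

theorem ensures_select (z : ℝ) : ∀ {fuel : ℕ} {xs : List ℝ} {k : ℕ}, xs.length < fuel →
    k < xs.length → (select z fuel xs k).Ensures mem (400 * (xs.length + 1)) (IsKth xs k)
  | 0, _, _, h, _ => absurd h (Nat.not_lt_zero _)
  | fuel + 1, xs, k, hfuel, hk => by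
      rw [select]
      split_ifs with hshort
      · refine Ensures.mono_cost ((ensures_charge _).bind_eq <|
          (ensures_insertionSort xs).bind_eq <| (ensures_charge _).bind_eq <|
            ensures_pure (isKth_getD_insertionSort hk z)) ?_
        rw [List.length_insertionSort]
        nlinarith
      refine Ensures.mono_cost (c := xs.length + 1 + (13 * xs.length + 1 + (xs.length / 5 + 1 +
        (400 * (xs.length / 5 + 1) + (3 * xs.length + 1 + (xs.length + 1 +
          (280 * xs.length + 880))))))) ?_ (by omega)
      refine (ensures_charge _).bind_eq <| (ensures_groupMedians xs).bind fun ms hms => ?_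
      rw [← hms.length_eq]
      have hmslen := hms.length_eq
      refine (ensures_charge _).bind_eq <|
        (ensures_select z (by omega) (by omega)).bind fun p hp => ?_
      refine (ensures_splitAt p xs).bind_eq <|
        ((ensures_charge _).mono_cost (by simpa using List.length_filter_le _ _)).bind_eq ?_
      have hlt := hms.ten_mul_countP_lt_le hp
      have hgt := hms.ten_mul_countP_gt_le hp
      have hle := countP_le_eq_countP_lt_add_countP_eq p xs
      have hlen := length_eq_countP_le_add_countP_gt p xs
      have hfilter_lt : (xs.filter (· < p)).length = xs.countP (· < p) :=
        List.countP_eq_length_filter.symm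
      have hfilter_gt : (xs.filter (p < ·)).length = xs.countP (p < ·) :=
        List.countP_eq_length_filter.symm
      simp only [hfilter_lt]
      split_ifs with hk_lt hk_le
      · exact (ensures_select z (by omega) (by omega)).mono (by omega) fun _ => IsKth.of_filter_lt
      · exact (ensures_pure ⟨not_lt.1 hk_lt, hle ▸ hk_le⟩).mono_cost (Nat.zero_le _)
      · rw [Nat.sub_sub, ← hle]
        exact (ensures_select z (by omega) (by omega)).mono (by omega)
          fun _ => IsKth.of_filter_gt (hle ▸ not_lt.1 hk_le)

theorem ensures_medianProg {r : ℕ} (hr : 0 < r) (t : Fin r → ℝ) :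
    (medianProg t).Ensures mem (801 * r + 806) (· = median t) := by
  have ensures_select_kth {k : ℕ} (hk : k < r) : (select 0 (r + 1) (List.ofFn t) k).Ensures mem
      (400 * (r + 1)) (· = (Finset.univ.val.map t).sort.getD k 0) := by
    simpa using (ensures_select (mem := mem) 0 (by simp) (by simpa using hk)).mono le_rfl
      fun _ h => h.unique (isKth_getD_sort_map t hk 0)
  have hlow := ensures_select_kth (k := (r - 1) / 2) (by omega)
  have hhigh := ensures_select_kth (k := r / 2) (by omega)
  constructor
  · simp [medianProg, median, hlow.1, hhigh.1]
  · have := hlow.2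
    have := hhigh.2
    simp [medianProg]
    omega

end Selection

/-! ### The sampling program -/

section ListLemmas

variable {α β : Type*}

theorem sum_map_filter_of_eq_zero {p : α → Bool} {f : α → ℝ} (h : ∀ a, p a = false → f a = 0)
    (l : List α) : ((l.filter p).map f).sum = (l.map f).sum := by
  induction l with
  | nil => rfl
  | cons a l ih => cases hp : p a <;> simp [hp, ih, h]

theorem flatten_map_ite_singleton (l : List α) (p : α → Prop) [DecidablePred p] (g : α → β) :
    (l.map fun a => if p a then [g a] else []).flatten = (l.filter (p ·)).map g := by
  induction l with
  | nil => rfl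
  | cons a l ih => by_cases h : p a <;> simp [h, ih]

end ListLemmas

section SparsityPattern

variable {n d : ℕ} {A : Matrix (Fin n) (Fin d) ℝ}

theorem eq_of_mem_sparsityPattern {q : Fin n × List (Fin d)} (hq : q ∈ sparsityPattern A) :
    q.2 = (List.finRange d).filter fun j => A q.1 j ≠ 0 := by
  obtain ⟨i, -, rfl⟩ := List.mem_map.1 (List.mem_filter.1 hq).1
  rfl

theorem length_pos_of_mem_sparsityPattern {q : Fin n × List (Fin d)}
    (hq : q ∈ sparsityPattern A) : 0 < q.2.length :=
  List.length_pos_iff.2 <| by simpa using (List.mem_filter.1 hq).2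

variable (A)

theorem map_fst_sparsityPattern : (sparsityPattern A).map Prod.fst =
    (List.finRange n).filter fun i => ∃ j, A i j ≠ 0 := by
  rw [sparsityPattern, List.filter_map, List.map_map, show Prod.fst ∘ _ = id from rfl, List.map_id]
  exact List.filter_congr fun i _ => Bool.eq_iff_iff.2 (by simp)

theorem sum_map_sparsityPattern {f : Fin n → ℝ} (h : ∀ i, A i = 0 → f i = 0) :
    ((sparsityPattern A).map fun q => f q.1).sum = ∑ i, f i := by
  have hmap : (sparsityPattern A).map (fun q => f q.1) =
      ((sparsityPattern A).map Prod.fst).map f := by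
    rw [List.map_map]
    rfl
  rw [hmap, map_fst_sparsityPattern, Fin.sum_univ_def]
  exact sum_map_filter_of_eq_zero (fun i hi => h i (funext (by simpa using hi))) _

theorem sum_length_sparsityPattern :
    ((sparsityPattern A).map fun q => q.2.length).sum = nnz A := by
  have hrow (i : Fin n) : ((List.finRange d).filter fun j => A i j ≠ 0).length =
      (Finset.univ.filter fun j => A i j ≠ 0).card := rfl
  have hnnz : nnz A = ((List.finRange n).map fun i =>
      ((List.finRange d).filter fun j => A i j ≠ 0).length).sum := by
    simp only [nnz, hrow, ← Fin.sum_univ_def, Finset.card_filter, ← Finset.univ_product_univ,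
      Finset.sum_product]
  rw [hnnz, sparsityPattern]
  induction List.finRange n with
  | nil => rfl
  | cons i l ih =>
    by_cases hi : (List.finRange d).filter (fun j => A i j ≠ 0) = []
    · simp_all
    · simp_all

theorem length_sparsityPattern_le : (sparsityPattern A).length ≤ nnz A := by
  simpa [← sum_length_sparsityPattern] using
    List.card_nsmul_le_sum ((sparsityPattern A).map fun q => q.2.length) 1
      (List.forall_mem_map.2 fun _ hq => length_pos_of_mem_sparsityPattern hq)

end SparsityPattern

theorem median_const {r : ℕ} (hr : 0 < r) (c : ℝ) : median (fun _ : Fin r => c) = c := by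
  have hsort {k : ℕ} (hk : k < r) :
      (Finset.univ.val.map fun _ : Fin r => c).sort.getD k 0 = c := by
    obtain ⟨_, h⟩ := (List.mem_ofFn' _ _).1 (isKth_getD_sort_map (fun _ : Fin r => c) hk 0).mem
    exact h.symm
  simp only [median, hsort (show (r - 1) / 2 < r by omega), hsort (show r / 2 < r by omega)]
  exact add_self_div_two c

section Program

variable {n d r : ℕ} {A : Matrix (Fin n) (Fin d) ℝ} {R : Matrix (Fin d) (Fin d) ℝ} {κ ε τ : ℝ}
  {ω : Seed n d r}

theorem rowEstimate_eq_zero (hr : 0 < r) (G : Matrix (Fin d) (Fin r) ℝ) {i : Fin n}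
    (h : A i = 0) : rowEstimate A R G i = 0 := by
  simp [rowEstimate, Matrix.mul_apply, h, median_const hr]

theorem keepProb_eq_zero (hr : 0 < r) (G : Matrix (Fin d) (Fin r) ℝ) {i : Fin n}
    (h : A i = 0) : keepProb A R κ ε τ G i = 0 := by
  simp [keepProb, rowEstimate_eq_zero hr G h]

theorem samplingMatrix_ne_zero_iff {i : Fin n} : samplingMatrix A R κ ε τ ω i i ≠ 0 ↔
    (ω.2 i : ℝ) < keepProb A R κ ε τ (Matrix.of ω.1) i := by
  simp only [samplingMatrix, Matrix.diagonal_apply_eq, ne_eq, ite_eq_right_iff, not_forall,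
    exists_prop, and_iff_left_iff_imp]
  exact fun h => (one_div_pos.2 ((ω.2 i).2.1.trans_lt h)).ne'

/-- The first stage of `samplingProg`: draw the matrix `Π₂`. -/
def cauchyProg {V : Type} : Comp (Cell n d r) V (Fin d → Fin r → V) :=
  tabulate d fun k => tabulate r fun l => readCell (.cauchy k l)

/-- The second stage of `samplingProg`: multiply `P` by `R⁻¹` from the left. -/
def productProg {V : Type} (P : Fin d → Fin r → V) : Comp (Cell n d r) V (Fin d → Fin r → V) :=
  tabulate d fun j => tabulate r fun l =>
    sumOver (fun k => do
      let x ← readCell (.inv j k)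
      times x (P k l)) (List.finRange d)

/-- The third stage of `samplingProg` on one row of `A`: the median of the absolute values of its
products with the columns of `G`. -/
def estimateProg {V : Type} (G : Fin d → Fin r → V) (q : Fin n × List (Fin d)) :
    Comp (Cell n d r) V (Fin n × V) := do
  let row ← tabulate r fun l => do
    let x ← sumOver (fun j => do
      let a ← readCell (.entry q.1 j)
      times a (G j l)) q.2
    absValue x
  let m ← medianProg row
  pure (q.1, m)

/-- The fourth stage of `samplingProg` on one row: turn the estimate into a probability. -/
def keepProbProg {V : Type} (total s : V) (e : Fin n × V) : Comp (Cell n d r) V (Fin n × V) := do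
  let x ← quotient e.2 total
  let y ← times s x
  let p ← minOne y
  pure (e.1, p)

/-- The last stage of `samplingProg` on one row: toss the coin. -/
def coinProg {V : Type} (e : Fin n × V) : Comp (Cell n d r) V (List (Fin n × V)) := do
  let u ← readCell (.coin e.1)
  let b ← isLess u e.2
  if b then do
    let one ← constant 1
    let w ← quotient one e.2
    pure [(e.1, w)]
  else pure []

theorem samplingProg_eq {V : Type} (rows : List (Fin n × List (Fin d))) :
    (samplingProg rows : Comp (Cell n d r) V (List (Fin n × V))) = (do
      let P ← cauchyProg
      let G ← productProg P
      let est ← forEach (estimateProg G) rows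
      let total ← sumOver (fun e => pure e.2) est
      let s ← sampleSizeProg
      let prob ← forEach (keepProbProg total s) est
      let out ← forEach coinProg prob
      charge (out.length + 1)
      pure out.flatten) := rfl

open QuantileSampling.Comp

theorem ensures_cauchyProg :
    (cauchyProg (V := ℝ)).Ensures (memory A R κ ε τ ω) (d * (2 * r + 2) + 1) (· = ω.1) :=
  (ensures_tabulate fun _ => ensures_tabulate (c := 1) fun _ => ⟨rfl, le_rfl⟩).mono_cost
    (by linarith)

theorem ensures_productProg (P : Fin d → Fin r → ℝ) :
    (productProg P).Ensures (memory A R κ ε τ ω) (d * (r * (4 * d + 2) + 2) + 1)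
      (· = R⁻¹ * Matrix.of P) := by
  have hentry (j : Fin d) (l : Fin r) : (sumOver (fun k => do
      let x ← readCell (.inv j k)
      times x (P k l)) (List.finRange d)).Ensures (memory A R κ ε τ ω) (4 * d + 1)
        (· = (R⁻¹ * Matrix.of P) j l) := by
    refine (ensures_sumOver (c := 2) (g := fun k => R⁻¹ j k * P k l)
      fun _ _ => ⟨rfl, le_rfl⟩).mono (by simp [mul_comm]) ?_
    rintro _ rfl
    simp [Matrix.mul_apply, Fin.sum_univ_def]
  exact (ensures_tabulate fun j => ensures_tabulate (hentry j)).mono_cost (by linarith)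

theorem ensures_estimateProg (hr : 0 < r) {q : Fin n × List (Fin d)} (hq : q ∈ sparsityPattern A) :
    (estimateProg (R⁻¹ * Matrix.of ω.1 : Matrix _ _ ℝ) q).Ensures (memory A R κ ε τ ω)
      (1617 * (r * q.2.length)) (· = (q.1, rowEstimate A R (Matrix.of ω.1) q.1)) := by
  set G : Matrix (Fin d) (Fin r) ℝ := R⁻¹ * Matrix.of ω.1
  have hentry (l : Fin r) : (do
      let x ← sumOver (fun j => do
        let a ← readCell (.entry q.1 j)
        times a (G j l)) q.2
      absValue x : Comp (Cell n d r) ℝ ℝ).Ensures (memory A R κ ε τ ω) (4 * q.2.length + 4)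
        (· = |(A * G) q.1 l|) := by
    refine ((ensures_sumOver (c := 2) (g := fun j => A q.1 j * G j l)
      fun _ _ => ⟨rfl, le_rfl⟩).bind_eq (ensures_absValue _)).mono (by linarith) ?_
    rintro _ rfl
    rw [eq_of_mem_sparsityPattern hq, Matrix.mul_apply, Fin.sum_univ_def,
      sum_map_filter_of_eq_zero fun j hj => by rw [of_decide_eq_false hj |> not_not.1, zero_mul]]
  refine Ensures.mono_cost ((ensures_tabulate hentry).bind_eq <|
    (ensures_medianProg hr _).bind_eq <| ensures_pure rfl) ?_
  have := Nat.mul_pos hr (length_pos_of_mem_sparsityPattern hq)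
  nlinarith [Nat.le_mul_of_pos_right r (length_pos_of_mem_sparsityPattern hq)]

theorem ensures_sampleSizeProg :
    (sampleSizeProg (V := ℝ)).Ensures (memory A R κ ε τ ω) 21 (· = sampleSize d κ ε τ) := by
  simp [Ensures, sampleSizeProg, sampleSize, memory, pow_two]

theorem ensures_keepProbProg (total s : ℝ) (e : Fin n × ℝ) :
    (keepProbProg total s e).Ensures (memory A R κ ε τ ω) 4
      (· = (e.1, min 1 (s * (e.2 / total)))) := by
  refine ⟨by simp [keepProbProg, (ensures_minOne _).1], ?_⟩
  have := (ensures_minOne (mem := memory A R κ ε τ ω) (s * (e.2 / total))).2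
  simp only [keepProbProg, run_bind, run_quotient, run_times, run_pure]
  omega

theorem ensures_coinProg (e : Fin n × ℝ) :
    (coinProg e).Ensures (memory A R κ ε τ ω) 4
      (· = if (ω.2 e.1 : ℝ) < e.2 then [(e.1, 1 / e.2)] else []) := by
  by_cases h : (ω.2 e.1 : ℝ) < e.2 <;> simp [Ensures, coinProg, memory, h]

theorem diagonalList_samplingMatrix (hr : 0 < r) :
    diagonalList (samplingMatrix A R κ ε τ ω) =
      ((sparsityPattern A).map fun q =>
        if (ω.2 q.1 : ℝ) < keepProb A R κ ε τ (Matrix.of ω.1) q.1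
        then [(q.1, 1 / keepProb A R κ ε τ (Matrix.of ω.1) q.1)] else []).flatten := by
  set p := keepProb A R κ ε τ (Matrix.of ω.1) with hp
  have hmap : ((sparsityPattern A).map fun q =>
      if (ω.2 q.1 : ℝ) < p q.1 then [(q.1, 1 / p q.1)] else []) =
      ((sparsityPattern A).map Prod.fst).map fun i =>
        if (ω.2 i : ℝ) < p i then [(i, 1 / p i)] else [] := by
    rw [List.map_map]
    rfl
  have hne {i : Fin n} (hi : (ω.2 i : ℝ) < p i) : ∃ j, A i j ≠ 0 := by
    by_contra! hA
    exact (ω.2 i).2.1.not_gt (by rwa [hp, keepProb_eq_zero hr _ (funext hA)] at hi)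
  rw [hmap, flatten_map_ite_singleton, map_fst_sparsityPattern, List.filter_filter, diagonalList]
  have hfilter : ((List.finRange n).filter fun i => samplingMatrix A R κ ε τ ω i i ≠ 0) =
      (List.finRange n).filter fun i => decide ((ω.2 i : ℝ) < p i) && decide (∃ j, A i j ≠ 0) :=
    List.filter_congr fun i _ => by
      rw [← Bool.decide_and, decide_eq_decide, samplingMatrix_ne_zero_iff]
      exact ⟨fun h => ⟨h, hne h⟩, And.left⟩
  rw [hfilter]
  refine List.map_congr_left fun i hi => ?_
  have hlt : (ω.2 i : ℝ) < p i :=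
    of_decide_eq_true (Bool.and_eq_true_iff.1 (List.mem_filter.1 hi).2).1
  rw [samplingMatrix, Matrix.diagonal_apply_eq, ← hp, if_pos hlt]

theorem ensures_samplingProg (hr : 0 < r) :
    (samplingProg (sparsityPattern A)).Ensures (memory A R κ ε τ ω)
      ((d * (2 * r + 2) + 1) + (d * (r * (4 * d + 2) + 2) + 1) +
        (1617 * r * nnz A + 14 * nnz A + 26)) (· = diagonalList (samplingMatrix A R κ ε τ ω)) := by
  have hlen := length_sparsityPattern_le A
  set rows := sparsityPattern A
  set lam := rowEstimate A R (Matrix.of ω.1)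
  have hest : (forEach (estimateProg (R⁻¹ * Matrix.of ω.1 : Matrix _ _ ℝ)) rows).Ensures
      (memory A R κ ε τ ω) (1617 * r * nnz A + nnz A + 1)
      (· = rows.map fun q => (q.1, lam q.1)) := by
    refine (ensures_forEach fun q hq => ensures_estimateProg hr hq).mono_cost ?_
    simp only [List.sum_map_add, List.sum_map_mul_left, sum_length_sparsityPattern,
      List.map_const', List.sum_replicate, smul_eq_mul, mul_one]
    linarith
  have htotal : (sumOver (fun e => pure e.2) (rows.map fun q => (q.1, lam q.1))).Ensures
      (memory A R κ ε τ ω) (2 * nnz A + 1) (· = ∑ i, lam i) := by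
    refine (ensures_sumOver (c := 0) fun _ _ => ensures_pure rfl).mono
      (by rw [List.length_map]; omega) ?_
    rintro _ rfl
    rw [List.map_map]
    exact sum_map_sparsityPattern A fun i hi => rowEstimate_eq_zero hr _ hi
  rw [samplingProg_eq]
  refine Ensures.mono_cost (ensures_cauchyProg.bind_eq <| (ensures_productProg _).bind_eq <|
    hest.bind_eq <| htotal.bind_eq <| ensures_sampleSizeProg.bind_eq <|
    (ensures_forEach fun e _ => ensures_keepProbProg _ _ e).bind_eq <|
    (ensures_forEach fun e _ => ensures_coinProg e).bind_eq <|
    (ensures_charge _).bind_eq <| ensures_pure ?_) ?_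
  · rw [diagonalList_samplingMatrix hr, List.map_map, List.map_map]
    rfl
  · simp only [List.map_map, List.map_const', List.sum_replicate, List.length_map, smul_eq_mul,
      Function.comp_def]
    omega

theorem execute_fst (hr : 0 < r) :
    (execute A R κ ε τ ω).1 = diagonalList (samplingMatrix A R κ ε τ ω) :=
  (ensures_samplingProg hr).1

theorem execute_snd_le (hr : 0 < r) (hd : 0 < d) :
    (execute A R κ ε τ ω).2 ≤ 2000 * (r * (nnz A + d ^ 2)) := by
  refine (ensures_samplingProg hr).2.trans ?_
  have hd_le : d ≤ d ^ 2 := Nat.le_self_pow two_ne_zero d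
  have hd_sq_le : d ^ 2 ≤ r * d ^ 2 := Nat.le_mul_of_pos_left _ hr
  have hrd_le : r * d ≤ r * d ^ 2 := Nat.mul_le_mul_left r hd_le
  have hnnz_le : nnz A ≤ r * nnz A := Nat.le_mul_of_pos_left _ hr
  have : 1 ≤ r * d ^ 2 := Nat.mul_pos hr (by positivity)
  nlinarith

end Program

theorem numProj_pos {n : ℕ} (hn : 0 < n) : 0 < numProj n := by
  have : (1 : ℝ) ≤ n := by exact_mod_cast hn
  exact Nat.ceil_pos.2 (mul_pos (by norm_num) (Real.log_pos (by linarith)))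

theorem numProj_le {n : ℕ} (hn : 2 ≤ n) : (numProj n : ℝ) ≤ 107 * Real.log n := by
  have hn' : (2 : ℝ) ≤ n := by exact_mod_cast hn
  have hlog : Real.log 2 ≤ Real.log n := Real.log_le_log two_pos hn'
  have hlog40 : Real.log 40 ≤ 6 * Real.log 2 := by
    calc Real.log 40 ≤ Real.log (2 ^ 6) := Real.log_le_log (by norm_num) (by norm_num)
      _ = 6 * Real.log 2 := by rw [Real.log_pow, Nat.cast_ofNat]
  have hmul : Real.log (40 * n) = Real.log 40 + Real.log n :=
    Real.log_mul (by norm_num) (by positivity)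
  have hceil := Nat.ceil_lt_add_one (a := 15 * Real.log (40 * n))
    (mul_nonneg (by norm_num) (Real.log_nonneg (by linarith)))
  rw [numProj]
  linarith [Real.log_two_gt_d9]

/-! ### The Cauchy distribution -/

section Cauchy

open Complex FourierTransform

theorem fourier_integrand_exp_neg_abs_eqOn_Iic (w : ℝ) : Set.EqOn
    (fun x : ℝ => cexp (↑(-2 * Real.pi * x * w) * I) • cexp (-|x|))
    (fun x : ℝ => cexp ((1 - 2 * Real.pi * w * I) * x)) (Set.Iic 0) := by
  intro x hx
  simp only [smul_eq_mul, ← Complex.exp_add, abs_of_nonpos (Set.mem_Iic.1 hx)]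
  congr 1
  push_cast
  ring

theorem fourier_integrand_exp_neg_abs_eqOn_Ioi (w : ℝ) : Set.EqOn
    (fun x : ℝ => cexp (↑(-2 * Real.pi * x * w) * I) • cexp (-|x|))
    (fun x : ℝ => cexp ((-1 - 2 * Real.pi * w * I) * x)) (Set.Ioi 0) := by
  intro x hx
  simp only [smul_eq_mul, ← Complex.exp_add, abs_of_pos (Set.mem_Ioi.1 hx)]
  congr 1
  push_cast
  ring

theorem integrableOn_Iic_fourier_integrand_exp_neg_abs (w : ℝ) : IntegrableOn
    (fun x : ℝ => cexp (↑(-2 * Real.pi * x * w) * I) • cexp (-|x|)) (Set.Iic 0) :=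
  (integrableOn_congr_fun (fourier_integrand_exp_neg_abs_eqOn_Iic w) measurableSet_Iic).2
    (integrableOn_exp_mul_complex_Iic (by simp) 0)

theorem integrableOn_Ioi_fourier_integrand_exp_neg_abs (w : ℝ) : IntegrableOn
    (fun x : ℝ => cexp (↑(-2 * Real.pi * x * w) * I) • cexp (-|x|)) (Set.Ioi 0) :=
  (integrableOn_congr_fun (fourier_integrand_exp_neg_abs_eqOn_Ioi w) measurableSet_Ioi).2
    (integrableOn_exp_mul_complex_Ioi (by simp) 0)

theorem fourier_exp_neg_abs (w : ℝ) :
    𝓕 (fun x : ℝ => cexp (-|x|)) w = ((2 / (1 + (2 * Real.pi * w) ^ 2) : ℝ) : ℂ) := by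
  have hre : 0 < (1 - 2 * Real.pi * w * I : ℂ).re := by simp
  have hre' : (-1 - 2 * Real.pi * w * I : ℂ).re < 0 := by simp
  have hne : (1 - 2 * Real.pi * w * I : ℂ) ≠ 0 := fun h => by simp [h] at hre
  have hne' : (-1 - 2 * Real.pi * w * I : ℂ) ≠ 0 := fun h => by simp [h] at hre'
  rw [Real.fourier_real_eq_integral_exp_smul, ← intervalIntegral.integral_Iic_add_Ioi (b := 0)
      (integrableOn_Iic_fourier_integrand_exp_neg_abs w)
      (integrableOn_Ioi_fourier_integrand_exp_neg_abs w),
    setIntegral_congr_fun measurableSet_Iic (fourier_integrand_exp_neg_abs_eqOn_Iic w),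
    setIntegral_congr_fun measurableSet_Ioi (fourier_integrand_exp_neg_abs_eqOn_Ioi w),
    integral_exp_mul_complex_Iic hre, integral_exp_mul_complex_Ioi hre']
  push_cast
  simp only [mul_zero, Complex.exp_zero]
  generalize (2 * Real.pi * w : ℂ) = x at hne hne'
  have hfactor : (1 + x ^ 2 : ℂ) = -((1 - x * I) * (-1 - x * I)) := by
    ring_nf
    simp only [I_sq]
    ring
  rw [hfactor]
  field_simp
  ring

theorem integrable_exp_neg_abs : Integrable fun x : ℝ => cexp (-|x|) := by
  rw [← integrableOn_univ, ← Set.Iic_union_Ioi (a := (0 : ℝ))]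
  simpa using (integrableOn_Iic_fourier_integrand_exp_neg_abs 0).union
    (integrableOn_Ioi_fourier_integrand_exp_neg_abs 0)

theorem integrable_fourier_exp_neg_abs : Integrable (𝓕 fun x : ℝ => cexp (-|x|)) := by
  rw [funext fourier_exp_neg_abs]
  have h := (integrable_inv_one_add_sq.comp_mul_left' (R := 2 * Real.pi)
    (by positivity)).const_mul 2
  simpa [div_eq_mul_inv] using h.ofReal (𝕜 := ℂ)

theorem charFun_cauchyMeasure (t : ℝ) : charFun (cauchyMeasure 0 1) t = Real.exp (-|t|) := by
  have hinv : (∫ w : ℝ, cexp (↑(2 * Real.pi * inner ℝ w t) * I) •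
      ((2 / (1 + (2 * Real.pi * w) ^ 2) : ℝ) : ℂ)) = cexp (-|t|) := by
    have h := congrFun (Continuous.fourierInv_fourier_eq (f := fun x : ℝ => cexp (-|x|))
      (by fun_prop) integrable_exp_neg_abs integrable_fourier_exp_neg_abs) t
    rwa [Real.fourierInv_eq', funext fourier_exp_neg_abs] at h
  have hscale := Measure.integral_comp_mul_left (fun y : ℝ =>
    (cauchyPDF 0 1 y).toReal • cexp (t * y * I)) (2 * Real.pi)
  rw [abs_of_pos (by positivity), eq_inv_smul_iff₀ (by positivity), ← integral_smul] at hscale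
  push_cast
  rw [← hinv, charFun_apply_real, cauchyMeasure_of_scale_ne_zero 0 one_ne_zero,
    integral_withDensity_eq_integral_toReal_smul (by fun_prop) (by simp [cauchyPDF]), ← hscale]
  refine integral_congr_ae (ae_of_all _ fun w => ?_)
  simp only [cauchyPDF, cauchyPDFReal, real_smul, smul_eq_mul, RCLike.inner_apply, conj_trivial]
  rw [ENNReal.toReal_ofReal (by positivity), mul_comm (cexp _), ← mul_assoc]
  congr 1
  · norm_cast
    field_simp
    ring
  · congr 1
    push_cast
    ring

theorem charFunDual_cauchyMeasure (L : StrongDual ℝ ℝ) :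
    charFunDual (cauchyMeasure 0 1) L = Real.exp (-|L 1|) := by
  rw [← charFun_cauchyMeasure, charFunDual_apply, charFun_apply_real]
  refine integral_congr_ae (ae_of_all _ fun x => ?_)
  have hL : L x = L 1 * x := by simpa [mul_comm] using L.map_smul x 1
  simp [hL]

theorem charFunDual_pi_cauchyMeasure {ι : Type*} [Fintype ι] [DecidableEq ι]
    (L : StrongDual ℝ (ι → ℝ)) : charFunDual (Measure.pi fun _ => cauchyMeasure 0 1) L =
      Real.exp (-∑ i, |L (Pi.single i 1)|) := by
  simp [charFunDual_pi, charFunDual_cauchyMeasure, ← Finset.sum_neg_distrib, Complex.exp_sum]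

/-- The law of a random matrix whose entries are independent and standard Cauchy, such as `Π₂`. -/
noncomputable abbrev cauchyLaw (ι κ : Type*) [Fintype ι] [Fintype κ] : Measure (ι → κ → ℝ) :=
  Measure.pi fun _ => Measure.pi fun _ => cauchyMeasure 0 1

theorem map_sum_smul_cauchyLaw {ι κ : Type*} [Fintype ι] [Fintype κ] (u : ι → ℝ) :
    (cauchyLaw ι κ).map (fun G => ∑ k, u k • G k) =
      (Measure.pi fun _ : κ => cauchyMeasure 0 1).map (fun x => (∑ k, |u k|) • x) := by
  classical
  let T : (ι → κ → ℝ) →L[ℝ] κ → ℝ := ∑ k, u k • ContinuousLinearMap.proj k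
  have hT : (fun G : ι → κ → ℝ => ∑ k, u k • G k) = T := by
    ext
    simp [T]
  have hsingle (k : ι) (y : κ → ℝ) : T (Pi.single k y) = u k • y := by
    simp [← hT, Pi.single_apply]
  let M : (κ → ℝ) →L[ℝ] κ → ℝ := (∑ k, |u k|) • ContinuousLinearMap.id ℝ _
  rw [hT, show (fun x : κ → ℝ => (∑ k, |u k|) • x) = M from rfl]
  have := Measure.isProbabilityMeasure_map (μ := cauchyLaw ι κ) T.continuous.aemeasurable
  have := Measure.isProbabilityMeasure_map (μ := Measure.pi fun _ : κ => cauchyMeasure 0 1)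
    M.continuous.aemeasurable
  refine Measure.ext_of_charFunDual (funext fun L => ?_)
  rw [charFunDual_map, charFunDual_map, charFunDual_pi, charFunDual_pi_cauchyMeasure]
  simp [charFunDual_pi_cauchyMeasure, hsingle, M, abs_mul, ← Complex.exp_sum, ← Finset.mul_sum,
    ← Finset.sum_mul, abs_of_nonneg (Finset.sum_nonneg fun k _ => abs_nonneg (u k))]

end Cauchy

theorem cauchyMeasure_real_abs_lt_le {a : ℝ} (ha : 0 ≤ a) :
    (cauchyMeasure 0 1).real {x | |x| < a} ≤ 2 * a / Real.pi := by
  have hs : {x : ℝ | |x| < a} = Set.Ioo (-a) a := by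
    ext
    simp [abs_lt]
  refine ENNReal.toReal_le_of_le_ofReal (by positivity) ?_
  rw [hs, cauchyMeasure_of_scale_ne_zero 0 one_ne_zero, withDensity_apply _ measurableSet_Ioo]
  calc ∫⁻ x in Set.Ioo (-a) a, cauchyPDF 0 1 x
      ≤ ∫⁻ _ in Set.Ioo (-a) a, ENNReal.ofReal Real.pi⁻¹ := by
        refine lintegral_mono fun _ => ENNReal.ofReal_le_ofReal ?_
        simp only [cauchyPDFReal, NNReal.coe_one, sub_zero, mul_one, one_pow]
        exact mul_le_of_le_one_right (by positivity)
          (inv_le_one_of_one_le₀ (by simp [sq_nonneg]))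
    _ = ENNReal.ofReal (2 * a / Real.pi) := by
        rw [setLIntegral_const, Real.volume_Ioo, ← ENNReal.ofReal_mul (by positivity)]
        congr 1
        ring

theorem setLIntegral_Ioi_cauchyPDF_le {b : ℝ} (hb : 0 < b) :
    ∫⁻ x in Set.Ioi b, cauchyPDF 0 1 x ≤ ENNReal.ofReal (1 / (b * Real.pi)) := by
  have hfint : IntegrableOn (fun x : ℝ => Real.pi⁻¹ * x ^ (-2 : ℝ)) (Set.Ioi b) :=
    (integrableOn_Ioi_rpow_of_lt (by norm_num) hb).const_mul _
  calc ∫⁻ x in Set.Ioi b, cauchyPDF 0 1 x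
      ≤ ∫⁻ x in Set.Ioi b, ENNReal.ofReal (Real.pi⁻¹ * x ^ (-2 : ℝ)) := by
        refine setLIntegral_mono' measurableSet_Ioi fun x hx => ENNReal.ofReal_le_ofReal ?_
        have hx0 : 0 < x := hb.trans hx
        simp only [cauchyPDFReal, NNReal.coe_one, sub_zero, mul_one, one_pow]
        rw [Real.rpow_neg hx0.le]
        norm_cast
        gcongr
        linarith
    _ = ENNReal.ofReal (∫ x in Set.Ioi b, Real.pi⁻¹ * x ^ (-2 : ℝ)) := by
        rw [ofReal_integral_eq_lintegral_ofReal hfint]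
        refine (ae_restrict_iff' measurableSet_Ioi).2 (ae_of_all _ fun x hx => ?_)
        have hx0 : 0 < x := hb.trans hx
        positivity
    _ = ENNReal.ofReal (1 / (b * Real.pi)) := by
        rw [integral_const_mul, integral_Ioi_rpow_of_lt (by norm_num) hb]
        congr 1
        norm_num [Real.rpow_neg_one]

theorem cauchyMeasure_real_lt_abs_le {b : ℝ} (hb : 0 < b) :
    (cauchyMeasure 0 1).real {x | b < |x|} ≤ 2 / (b * Real.pi) := by
  have hs : {x : ℝ | b < |x|} = Set.Iio (-b) ∪ Set.Ioi b := by
    ext x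
    simp [lt_abs, or_comm, lt_neg]
  have hneg : ∫⁻ x in Set.Iio (-b), cauchyPDF 0 1 x = ∫⁻ x in Set.Ioi b, cauchyPDF 0 1 x := by
    have h := (Measure.measurePreserving_neg (volume : Measure ℝ)).setLIntegral_comp_preimage_emb
      (MeasurableEquiv.neg ℝ).measurableEmbedding (cauchyPDF 0 1) (Set.Ioi b)
    simpa [cauchyPDF, cauchyPDFReal] using h
  refine ENNReal.toReal_le_of_le_ofReal (by positivity) ?_
  rw [hs, cauchyMeasure_of_scale_ne_zero 0 one_ne_zero,
    withDensity_apply _ (measurableSet_Iio.union measurableSet_Ioi)]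
  calc ∫⁻ x in Set.Iio (-b) ∪ Set.Ioi b, cauchyPDF 0 1 x
      ≤ ENNReal.ofReal (1 / (b * Real.pi)) + ENNReal.ofReal (1 / (b * Real.pi)) :=
        (lintegral_union_le _ _ _).trans <| by
          rw [hneg]
          exact add_le_add (setLIntegral_Ioi_cauchyPDF_le hb) (setLIntegral_Ioi_cauchyPDF_le hb)
    _ = ENNReal.ofReal (2 / (b * Real.pi)) := by
        rw [← ENNReal.ofReal_add (by positivity) (by positivity)]
        congr 1
        ring

/-! ### Medians of random vectors -/

theorem countP_ofFn {α : Type*} {r : ℕ} (f : Fin r → α) (p : α → Prop) [DecidablePred p] :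
    (List.ofFn f).countP (p ·) = (Finset.univ.filter fun i => p (f i)).card := by
  rw [List.ofFn_eq_map, List.countP_map, List.countP_eq_length_filter]
  rfl

section Median

variable {r : ℕ} (hr : 0 < r)
include hr

theorem le_two_mul_card_of_median_lt {f : Fin r → ℝ} {a : ℝ} (h : median f < a) :
    r ≤ 2 * (Finset.univ.filter fun l => f l < a).card := by
  have hx := isKth_getD_sort_map f (show (r - 1) / 2 < r by omega) 0
  have hy := isKth_getD_sort_map f (show r / 2 < r by omega) 0
  have hle := hx.le_of_le hy (by omega)
  rw [median] at h
  have hlt := hx.2.trans_le (countP_mono (fun z hz => lt_of_le_of_lt hz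
    (show _ < a by linarith)) (List.ofFn f))
  rw [countP_ofFn f (· < a)] at hlt
  omega

theorem le_two_mul_card_of_lt_median {f : Fin r → ℝ} {b : ℝ} (h : b < median f) :
    r ≤ 2 * (Finset.univ.filter fun l => b < f l).card := by
  have hx := isKth_getD_sort_map f (show (r - 1) / 2 < r by omega) 0
  have hy := isKth_getD_sort_map f (show r / 2 < r by omega) 0
  have hle := hx.le_of_le hy (by omega)
  set y := (Finset.univ.val.map f).sort.getD (r / 2) 0
  rw [median] at h
  have hby : b < y := by linarith
  have hge : (List.ofFn f).countP (y ≤ ·) ≤ (List.ofFn f).countP (b < ·) :=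
    countP_mono (fun _ => hby.trans_le) _
  have hlen := length_eq_countP_lt_add_countP_ge y (List.ofFn f)
  rw [countP_ofFn f (b < ·)] at hge
  rw [List.length_ofFn] at hlen
  have := hy.1
  omega

theorem median_const_mul {c : ℝ} (hc : 0 ≤ c) (f : Fin r → ℝ) :
    median (fun i => c * f i) = c * median f := by
  have hsort {k : ℕ} (hk : k < r) : (Finset.univ.val.map fun i => c * f i).sort.getD k 0 =
      c * (Finset.univ.val.map f).sort.getD k 0 := by
    refine (isKth_getD_sort_map _ hk 0).unique ?_
    rw [List.ofFn_comp' f (c * ·)]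
    exact (isKth_getD_sort_map f hk 0).map fun _ _ h => mul_le_mul_of_nonneg_left h hc
  simp only [median, hsort (show (r - 1) / 2 < r by omega), hsort (show r / 2 < r by omega)]
  ring

theorem measurable_median : Measurable (median : (Fin r → ℝ) → ℝ) := by
  have hsort {k : ℕ} (hk : k < r) :
      Measurable fun f : Fin r → ℝ => (Finset.univ.val.map f).sort.getD k 0 := by
    refine measurable_of_Iio fun x => ?_
    have hIio : (fun f : Fin r → ℝ => (Finset.univ.val.map f).sort.getD k 0) ⁻¹' Set.Iio x =
        {f | k < ∑ i, if f i < x then 1 else 0} := by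
      ext f
      rw [Set.mem_preimage, Set.mem_Iio, (isKth_getD_sort_map f hk 0).lt_iff,
        countP_ofFn f (· < x), Set.mem_ofPred_eq, Finset.card_filter]
    rw [hIio]
    exact measurableSet_lt measurable_const <| Finset.measurable_sum _ fun i _ =>
      Measurable.ite (measurableSet_lt (measurable_pi_apply i) measurable_const)
        measurable_const measurable_const
  exact ((hsort (by omega)).add (hsort (by omega))).div_const 2

end Median

section Product

variable {ι Ω : Type*} [Fintype ι] [MeasurableSpace Ω] (ν : Measure Ω) [IsProbabilityMeasure ν]

theorem measureReal_pi_le_prod_le {f : ι → Ω → ℝ} (hf : ∀ i x, 0 ≤ f i x)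
    (hfi : ∀ i, Integrable (f i) ν) {t : ℝ} (ht : 0 < t) :
    (Measure.pi fun _ : ι => ν).real {x | t ≤ ∏ i, f i (x i)} ≤ (∏ i, ∫ x, f i x ∂ν) / t := by
  rw [le_div_iff₀' ht, ← integral_fintype_prod_eq_prod]
  exact mul_meas_ge_le_integral_of_nonneg
    (ae_of_all _ fun x => Finset.prod_nonneg fun i _ => hf i (x i))
    (Integrable.fintype_prod hfi) t

theorem measureReal_pi_le_card_le {s : ι → Set Ω} [∀ i, DecidablePred (· ∈ s i)]
    (hs : ∀ i, MeasurableSet (s i)) {c : ℝ} (hc : 1 ≤ c) (t : ℝ) :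
    (Measure.pi fun _ : ι => ν).real {x | t ≤ (Finset.univ.filter fun i => x i ∈ s i).card} ≤
      (∏ i, (1 + (c - 1) * ν.real (s i))) / c ^ t := by
  have hfint (i : ι) : Integrable ((s i).indicator fun _ => c - 1) ν :=
    (integrable_const _).indicator (hs i)
  have hmarkov := measureReal_pi_le_prod_le ν
    (f := fun i x => 1 + (s i).indicator (fun _ => c - 1) x)
    (fun i x => add_nonneg zero_le_one (Set.indicator_nonneg (fun _ _ => sub_nonneg.2 hc) x))
    (fun i => (integrable_const 1).add (hfint i)) (Real.rpow_pos_of_pos (by linarith : 0 < c) t)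
  simp only [integral_add (integrable_const _) (hfint _), integral_indicator (hs _),
    integral_const, probReal_univ, measureReal_restrict_apply_univ, smul_eq_mul, one_mul,
    mul_comm (ν.real _)] at hmarkov
  refine (measureReal_mono fun x hx => ?_).trans hmarkov
  have hfactor (i : ι) :
      1 + (s i).indicator (fun _ => c - 1) (x i) = if x i ∈ s i then c else 1 := by
    by_cases h : x i ∈ s i <;> simp [h]
  rw [Set.mem_ofPred_eq]
  simp only [hfactor, Finset.prod_ite, Finset.prod_const, one_pow, mul_one]
  rw [← Real.rpow_natCast]
  exact Real.rpow_le_rpow_of_exponent_le hc hx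

end Product

theorem pow_numProj_le {n : ℕ} (hn : 0 < n) {p : ℝ} (hp0 : 0 ≤ p) (hp : p ≤ 9 / 10 / Real.pi) :
    ((1 + 3 * p) / 2) ^ numProj n ≤ 1 / (40 * n) := by
  have hp' : p ≤ 9 / 10 / 3.14 :=
    hp.trans (div_le_div_of_nonneg_left (by norm_num) (by norm_num) Real.pi_gt_d2.le)
  have hexp : (1 + 3 * p) / 2 ≤ Real.exp (-(1 / 15)) := by
    have := Real.add_one_le_exp (-(1 / 15))
    norm_num at hp'
    linarith
  have hlog : 15 * Real.log (40 * n) ≤ numProj n := Nat.le_ceil _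
  calc ((1 + 3 * p) / 2) ^ numProj n ≤ Real.exp (-(1 / 15)) ^ numProj n := by gcongr
    _ = Real.exp (-(numProj n / 15)) := by
        rw [← Real.exp_nat_mul]
        ring_nf
    _ ≤ Real.exp (-Real.log (40 * n)) := Real.exp_le_exp.2 (by linarith)
    _ = 1 / (40 * n) := by rw [Real.exp_neg, Real.exp_log (by positivity), one_div]

theorem measureReal_median_abs_notMem_le {n : ℕ} (hn : 0 < n) :
    (Measure.pi fun _ : Fin (numProj n) => cauchyMeasure 0 1).real
      {x | median (fun l => |x l|) ∉ Set.Icc (9 / 20) (20 / 9)} ≤ 1 / (20 * n) := by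
  have hr := numProj_pos hn
  have hhalf {s : Set ℝ} (hs : MeasurableSet s)
      (hp : (cauchyMeasure 0 1).real s ≤ 9 / 10 / Real.pi) [DecidablePred (· ∈ s)] :
      (Measure.pi fun _ : Fin (numProj n) => cauchyMeasure 0 1).real
        {x | numProj n ≤ 2 * (Finset.univ.filter fun l => x l ∈ s).card} ≤ 1 / (40 * n) := by
    refine le_trans (measureReal_mono fun x hx => ?_) <|
      (measureReal_pi_le_card_le (cauchyMeasure 0 1) (fun _ : Fin (numProj n) => hs)
        (show (1 : ℝ) ≤ 4 by norm_num) (numProj n / 2)).trans ?_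
    · rw [Set.mem_ofPred_eq, div_le_iff₀' two_pos]
      exact_mod_cast hx
    · rw [show (4 : ℝ) = 2 ^ (2 : ℝ) by norm_num, ← Real.rpow_mul zero_le_two,
        mul_div_cancel₀ _ two_ne_zero, Real.rpow_natCast, Finset.prod_const, Finset.card_univ,
        Fintype.card_fin, ← div_pow]
      norm_num1
      exact pow_numProj_le hn measureReal_nonneg hp
  have hsmall := hhalf (s := {x | |x| < 9 / 20})
    (measurableSet_lt measurable_id.abs measurable_const)
    ((cauchyMeasure_real_abs_lt_le (by norm_num)).trans_eq (by ring))
  have hlarge := hhalf (s := {x | 20 / 9 < |x|})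
    (measurableSet_lt measurable_const measurable_id.abs)
    ((cauchyMeasure_real_lt_abs_le (by norm_num)).trans_eq (by field_simp; norm_num))
  calc _ ≤ _ := measureReal_mono fun x hx => ?_
    _ ≤ _ := (measureReal_union_le _ _).trans (add_le_add hsmall hlarge)
    _ = 1 / (20 * n : ℝ) := by
        field_simp
        norm_num
  simp only [Set.mem_ofPred_eq, Set.mem_Icc, not_and_or, not_le] at hx
  exact hx.imp (le_two_mul_card_of_median_lt hr) (le_two_mul_card_of_lt_median hr)

theorem measureReal_median_sum_notMem_le {n : ℕ} {ι : Type*} [Fintype ι] (hn : 0 < n) (u : ι → ℝ) :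
    (cauchyLaw ι (Fin (numProj n))).real
      {G | median (fun l => |∑ k, u k * G k l|) ∉
        Set.Icc (9 / 20 * ∑ k, |u k|) (20 / 9 * ∑ k, |u k|)} ≤ 1 / (20 * n) := by
  have hr := numProj_pos hn
  have hc : 0 ≤ ∑ k, |u k| := Finset.sum_nonneg fun k _ => abs_nonneg (u k)
  set c := ∑ k, |u k|
  set T : Set (Fin (numProj n) → ℝ) :=
    {y | median (fun l => |y l|) ∉ Set.Icc (9 / 20 * c) (20 / 9 * c)}
  have hT : MeasurableSet T :=
    (((measurable_median hr).comp (by fun_prop)) measurableSet_Icc).compl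
  have hmap : (cauchyLaw ι (Fin (numProj n))).real {G | ∑ k, u k • G k ∈ T} =
      (Measure.pi fun _ => cauchyMeasure 0 1).real {x | c • x ∈ T} := by
    have h := congrArg (·.real T) (map_sum_smul_cauchyLaw (κ := Fin (numProj n)) u)
    rw [map_measureReal_apply (by fun_prop) hT, map_measureReal_apply (by fun_prop) hT] at h
    exact h
  calc _ = (cauchyLaw ι (Fin (numProj n))).real {G | ∑ k, u k • G k ∈ T} := by simp [T]
    _ = _ := hmap
    _ ≤ (Measure.pi fun _ => cauchyMeasure 0 1).real
          {x | median (fun l => |x l|) ∉ Set.Icc (9 / 20) (20 / 9)} :=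
        measureReal_mono fun x hx hx' => hx ?_
    _ ≤ _ := measureReal_median_abs_notMem_le hn
  simp only [Pi.smul_apply, smul_eq_mul, abs_mul, abs_of_nonneg hc, median_const_mul hr hc,
    mul_comm _ c]
  exact ⟨mul_le_mul_of_nonneg_left hx'.1 hc, mul_le_mul_of_nonneg_left hx'.2 hc⟩

section RowEstimates

variable {n d r : ℕ} (A : Matrix (Fin n) (Fin d) ℝ) (R : Matrix (Fin d) (Fin d) ℝ)

/-- The `λ_i` approximate the `ℓ1` norms of the rows of `A R⁻¹` up to constant factors. -/
def GoodEstimates (G : Fin d → Fin r → ℝ) : Prop :=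
  ∀ i, rowEstimate A R (Matrix.of G) i ∈
    Set.Icc (9 / 20 * ∑ k, |(A * R⁻¹) i k|) (20 / 9 * ∑ k, |(A * R⁻¹) i k|)

theorem rowEstimate_eq_median (G : Fin d → Fin r → ℝ) (i : Fin n) :
    rowEstimate A R (Matrix.of G) i = median fun l => |∑ k, (A * R⁻¹) i k * G k l| := by
  rw [rowEstimate, ← Matrix.mul_assoc]
  rfl

theorem measurable_rowEstimate (hr : 0 < r) (i : Fin n) :
    Measurable fun G : Fin d → Fin r → ℝ => rowEstimate A R (Matrix.of G) i := by
  simp only [rowEstimate_eq_median]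
  exact (measurable_median hr).comp (by fun_prop)

theorem measurable_keepProb (hr : 0 < r) (κ ε τ : ℝ) (i : Fin n) :
    Measurable fun G : Fin d → Fin r → ℝ => keepProb A R κ ε τ (Matrix.of G) i :=
  measurable_const.min <| ((measurable_rowEstimate A R hr i).div <|
    Finset.measurable_sum _ fun k _ => measurable_rowEstimate A R hr k).const_mul _

theorem measureReal_not_goodEstimates_le (hn : 0 < n) :
    (cauchyLaw (Fin d) (Fin (numProj n))).real {G | ¬ GoodEstimates A R G} ≤ 1 / 20 := by
  calc _ = (cauchyLaw (Fin d) (Fin (numProj n))).real (⋃ i,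
        {G | median (fun l => |∑ k, (A * R⁻¹) i k * G k l|) ∉
          Set.Icc (9 / 20 * ∑ k, |(A * R⁻¹) i k|) (20 / 9 * ∑ k, |(A * R⁻¹) i k|)}) := by
        congr 1
        ext G
        simp only [GoodEstimates, rowEstimate_eq_median, not_forall, Set.mem_ofPred_eq,
          Set.mem_iUnion]
    _ ≤ ∑ i : Fin n, 1 / (20 * n : ℝ) := (measureReal_iUnion_fintype_le _).trans <|
        Finset.sum_le_sum fun i _ => measureReal_median_sum_notMem_le hn _
    _ = 1 / 20 := by
        simp
        field_simp

end RowEstimates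

/-! ### Independent coin tosses -/

section Coins

theorem measurableSet_coe_lt (p : ℝ) : MeasurableSet {u : unitInterval | (u : ℝ) < p} :=
  measurableSet_lt measurable_subtype_coe measurable_const

theorem volume_real_coe_lt {p : ℝ} (h0 : 0 ≤ p) (h1 : p ≤ 1) :
    (volume : Measure unitInterval).real {u | (u : ℝ) < p} = p := by
  have h : {u : unitInterval | (u : ℝ) < p} = Set.Iio ⟨p, h0, h1⟩ := rfl
  rw [h, Measure.real, unitInterval.volume_Iio, ENNReal.toReal_ofReal h0]

theorem comp_ite_coe_lt_eq (f : ℝ → ℝ) (p a : ℝ) :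
    (fun u : unitInterval => f (if (u : ℝ) < p then a else 0)) =
      fun u => f 0 + {u : unitInterval | (u : ℝ) < p}.indicator (fun _ => f a - f 0) u := by
  ext u
  by_cases h : (u : ℝ) < p <;> simp [h]

theorem integrable_comp_ite_coe_lt (f : ℝ → ℝ) (p a : ℝ) :
    Integrable fun u : unitInterval => f (if (u : ℝ) < p then a else 0) := by
  rw [comp_ite_coe_lt_eq]
  exact (integrable_const _).add ((integrable_const _).indicator (measurableSet_coe_lt p))

theorem integral_comp_ite_coe_lt {p : ℝ} (h0 : 0 ≤ p) (h1 : p ≤ 1) (f : ℝ → ℝ) (a : ℝ) :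
    ∫ u : unitInterval, f (if (u : ℝ) < p then a else 0) = f 0 + p * (f a - f 0) := by
  rw [comp_ite_coe_lt_eq, integral_add (integrable_const _)
    ((integrable_const _).indicator (measurableSet_coe_lt p)),
    integral_indicator (measurableSet_coe_lt p)]
  simp [volume_real_coe_lt h0 h1]

theorem integral_exp_mul_ite_coe_lt_le {p w M θ : ℝ} (h0 : 0 ≤ p) (h1 : p ≤ 1) (hw : 0 ≤ w)
    (hM : 0 < M) (h : p < 1 → w ≤ M * p) (hθ : |θ| * M ≤ 1) :
    ∫ u : unitInterval, Real.exp (θ * if (u : ℝ) < p then w / p else 0) ≤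
      Real.exp (θ * w + θ ^ 2 * M * w) := by
  rw [integral_comp_ite_coe_lt h0 h1 (fun z => Real.exp (θ * z)), mul_zero, Real.exp_zero]
  have hMw : 0 ≤ θ ^ 2 * M * w := by positivity
  rcases h1.eq_or_lt with rfl | h1
  · rw [div_one, one_mul, add_sub_cancel]
    exact Real.exp_le_exp.2 (by linarith)
  rcases h0.eq_or_lt with rfl | h0
  · have hw0 : w = 0 := le_antisymm (by linarith [h h1]) hw
    simp [hw0]
  have hle : w / p ≤ M := (div_le_iff₀ h0).2 (h h1)
  have habs : |θ * (w / p)| ≤ 1 := by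
    rw [abs_mul, abs_of_nonneg (by positivity : 0 ≤ w / p)]
    exact (mul_le_mul_of_nonneg_left hle (abs_nonneg θ)).trans hθ
  calc 1 + p * (Real.exp (θ * (w / p)) - 1)
      ≤ 1 + p * (θ * (w / p) + (θ * (w / p)) ^ 2) := by
        have := (abs_le.1 (Real.abs_exp_sub_one_sub_id_le habs)).2
        gcongr
        linarith
    _ = 1 + (θ * w + θ ^ 2 * (w / p) * w) := by field_simp
    _ ≤ θ * w + θ ^ 2 * M * w + 1 := by
        rw [add_comm 1]
        gcongr
    _ ≤ Real.exp (θ * w + θ ^ 2 * M * w) := Real.add_one_le_exp _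

variable {ι : Type*} [Fintype ι]

/-- The Horvitz–Thompson estimator of `∑ i, w i` from a sample in which the index `i` is kept with
probability `p i`, namely when the uniform variable `u i` is below `p i`. -/
noncomputable def horvitzThompson (p w : ι → ℝ) (u : ι → unitInterval) : ℝ :=
  ∑ i, if (u i : ℝ) < p i then w i / p i else 0

variable {p w : ι → ℝ} {M : ℝ} (h0 : ∀ i, 0 ≤ p i) (h1 : ∀ i, p i ≤ 1) (hw : ∀ i, 0 ≤ w i)
  (hM : 0 < M) (h : ∀ i, p i < 1 → w i ≤ M * p i)
include h0 h1 hw hM h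

theorem measureReal_le_mul_horvitzThompson_le {θ : ℝ} (hθ : |θ| * M ≤ 1) (t : ℝ) :
    (Measure.pi fun _ : ι => (volume : Measure unitInterval)).real
      {u | t ≤ θ * horvitzThompson p w u} ≤
        Real.exp (θ * ∑ i, w i + θ ^ 2 * M * ∑ i, w i - t) := by
  have hmarkov := measureReal_pi_le_prod_le (volume : Measure unitInterval)
    (f := fun i u => Real.exp (θ * if (u : ℝ) < p i then w i / p i else 0))
    (fun _ _ => (Real.exp_pos _).le)
    (fun i => integrable_comp_ite_coe_lt (fun z => Real.exp (θ * z)) (p i) (w i / p i))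
    (Real.exp_pos t)
  simp only [← Real.exp_sum, ← Finset.mul_sum, Real.exp_le_exp] at hmarkov
  refine hmarkov.trans ?_
  rw [Real.exp_sub, Finset.mul_sum, Finset.mul_sum, ← Finset.sum_add_distrib, Real.exp_sum]
  exact div_le_div_of_nonneg_right (Finset.prod_le_prod
    (fun _ _ => integral_nonneg fun _ => (Real.exp_pos _).le) fun i _ =>
      integral_exp_mul_ite_coe_lt_le (h0 i) (h1 i) (hw i) hM (h i) hθ) (Real.exp_pos t).le

theorem measureReal_lt_abs_horvitzThompson_sub_le {t : ℝ} (ht0 : 0 ≤ t) (ht : t ≤ 2) :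
    (Measure.pi fun _ : ι => (volume : Measure unitInterval)).real
      {u | t * ∑ i, w i < |horvitzThompson p w u - ∑ i, w i|} ≤
        2 * Real.exp (-(t ^ 2 * (∑ i, w i) / (4 * M))) := by
  set W := ∑ i, w i
  have hone {θ : ℝ} (hθ : |θ| = t / (2 * M)) :
      (Measure.pi fun _ : ι => (volume : Measure unitInterval)).real
        {u | θ * W + |θ| * (t * W) ≤ θ * horvitzThompson p w u} ≤
          Real.exp (-(t ^ 2 * W / (4 * M))) := by
    have hθM : |θ| * M ≤ 1 := by
      rw [hθ]
      field_simp
      linarith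
    refine (measureReal_le_mul_horvitzThompson_le h0 h1 hw hM h hθM _).trans_eq ?_
    rw [← sq_abs, hθ]
    congr 1
    field_simp
    ring
  set θ := t / (2 * M)
  have hθ : 0 ≤ θ := by positivity
  rw [two_mul (Real.exp _)]
  refine (measureReal_mono fun u hu => ?_).trans <| (measureReal_union_le _ _).trans
    (add_le_add (hone (abs_of_nonneg hθ)) (hone (θ := -θ) (by rw [abs_neg, abs_of_nonneg hθ])))
  simp only [Set.mem_union, Set.mem_ofPred_eq, abs_neg, abs_of_nonneg hθ] at hu ⊢
  refine (lt_abs.1 hu).imp (fun hu => ?_) fun hu => ?_ <;>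
  · have := mul_le_mul_of_nonneg_left hu.le hθ
    linarith

end Coins

/-! ### Nets of unit spheres -/

section Net

open Metric Module
open scoped NNReal ENNReal

variable {E : Type*} [NormedAddCommGroup E] [NormedSpace ℝ E] [FiniteDimensional ℝ E]

theorem card_le_of_isSeparated {γ : ℝ≥0} (hγ : 0 < γ) {s : Finset E}
    (hs : (s : Set E) ⊆ closedBall 0 1) (hsep : IsSeparated γ (s : Set E)) :
    (s.card : ℝ) ≤ (1 + 2 / γ) ^ finrank ℝ E := by
  borelize E
  let μ : Measure E := Measure.addHaar
  have hγ' : (0 : ℝ) < γ := hγ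
  have hball (x : E) {r : ℝ} (hr : 0 < r) :
      μ.real (ball x r) = r ^ finrank ℝ E * μ.real (ball 0 1) := by
    simp [measureReal_def, μ.addHaar_ball_of_pos x hr, ENNReal.toReal_ofReal (pow_nonneg hr.le _)]
  have hpos : 0 < μ.real (ball (0 : E) 1) :=
    ENNReal.toReal_pos (measure_ball_pos μ _ one_pos).ne' measure_ball_lt_top.ne
  have hdisj : (s : Set E).PairwiseDisjoint fun x => ball x (γ / 2 : ℝ) := by
    intro x hx y hy hxy
    have : (γ : ℝ≥0∞) < edist x y := hsep hx hy hxy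
    rw [edist_nndist, ENNReal.coe_lt_coe] at this
    exact ball_disjoint_ball (by rw [add_halves]; exact_mod_cast this.le)
  have hsub : ⋃ x ∈ s, ball x (γ / 2 : ℝ) ⊆ ball (0 : E) (1 + γ / 2) :=
    Set.iUnion₂_subset fun x hx => ball_subset_ball' (by linarith [mem_closedBall.1 (hs hx)])
  have hvol : s.card * ((γ / 2 : ℝ) ^ finrank ℝ E * μ.real (ball 0 1)) ≤
      (1 + γ / 2 : ℝ) ^ finrank ℝ E * μ.real (ball 0 1) := by
    calc _ = μ.real (⋃ x ∈ s, ball x (γ / 2 : ℝ)) := by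
          rw [measureReal_biUnion_finset hdisj fun _ _ => measurableSet_ball]
          simp [hball _ (half_pos hγ')]
      _ ≤ μ.real (ball 0 (1 + γ / 2 : ℝ)) := measureReal_mono hsub
      _ = _ := hball 0 (by positivity)
  have hratio : (1 + 2 / γ : ℝ) = (1 + γ / 2) / (γ / 2) := by
    field_simp
    ring
  rw [hratio, div_pow, le_div_iff₀ (by positivity)]
  rw [← mul_assoc] at hvol
  exact le_of_mul_le_mul_right hvol hpos

theorem exists_isCover_sphere {γ : ℝ≥0} (hγ : 0 < γ) :
    ∃ s : Finset E, (s : Set E) ⊆ sphere 0 1 ∧ (s.card : ℝ) ≤ (1 + 2 / γ) ^ finrank ℝ E ∧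
      IsCover γ (sphere (0 : E) 1) s := by
  have hpack : packingNumber γ (sphere (0 : E) 1) ≠ ⊤ := by
    set m := ⌊(1 + 2 / γ : ℝ) ^ finrank ℝ E⌋₊ with hm
    refine ((iSup₂_le fun C hC => iSup_le fun hsep => ?_).trans_lt (ENat.natCast_lt_top m)).ne
    by_contra! hlt
    obtain ⟨t, htC, ht⟩ := Set.exists_subset_encard_eq (Order.add_one_le_of_lt hlt)
    lift t to Finset E using Set.finite_of_encard_eq_coe (by exact_mod_cast ht)
    rw [Set.encard_coe_eq_coe_finsetCard] at ht
    have := Nat.le_floor (card_le_of_isSeparated hγ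
      ((htC.trans hC).trans sphere_subset_closedBall) (hsep.subset htC))
    rw [← hm] at this
    norm_cast at ht
    omega
  have hsub := maximalSeparatedSet_subset (ε := γ) (A := sphere (0 : E) 1)
  have hsep := isSeparated_maximalSeparatedSet (ε := γ) (A := sphere (0 : E) 1)
  have hcov := isCover_maximalSeparatedSet hpack
  have hfin : (maximalSeparatedSet γ (sphere (0 : E) 1)).Finite :=
    Set.encard_ne_top_iff.1 ((encard_maximalSeparatedSet hpack).trans_ne hpack)
  lift maximalSeparatedSet γ (sphere (0 : E) 1) to Finset E using hfin with s
  exact ⟨s, hsub, card_le_of_isSeparated hγ (hsub.trans sphere_subset_closedBall) hsep, hcov⟩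

end Net

/-! ### Sublinear functionals -/

section Sublinear

open Metric
open scoped NNReal

/-- A sublinear functional: subadditive and positively homogeneous. -/
structure IsSublinear {V : Type*} [AddCommGroup V] [Module ℝ V] (p : V → ℝ) : Prop where
  map_add_le (v w : V) : p (v + w) ≤ p v + p w
  map_smul {c : ℝ} (hc : 0 ≤ c) (v : V) : p (c • v) = c * p v

theorem IsSublinear.comp {V W : Type*} [AddCommGroup V] [Module ℝ V] [AddCommGroup W] [Module ℝ W]
    {p : W → ℝ} (hp : IsSublinear p) (f : V →ₗ[ℝ] W) : IsSublinear fun v => p (f v) where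
  map_add_le v w := by
    rw [f.map_add]
    exact hp.map_add_le _ _
  map_smul hc v := by
    rw [f.map_smul, hp.map_smul hc]

theorem IsSublinear.le_add_sub {V : Type*} [AddCommGroup V] [Module ℝ V] {p : V → ℝ}
    (hp : IsSublinear p) (v w : V) : p v ≤ p w + p (v - w) := by
  simpa only [add_sub_cancel] using hp.map_add_le w (v - w)

variable {V : Type*} [NormedAddCommGroup V] [NormedSpace ℝ V]

theorem nonpos_of_nonpos_on_sphere {f : V → ℝ} (hf : ∀ c : ℝ, 0 ≤ c → ∀ v, f (c • v) = c * f v)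
    (h : ∀ v ∈ sphere (0 : V) 1, f v ≤ 0) (v : V) : f v ≤ 0 := by
  rcases eq_or_ne v 0 with rfl | hv
  · simpa using (hf 0 le_rfl 0).le
  · have hpos := norm_pos_iff.2 hv
    have hunit := h (‖v‖⁻¹ • v) (by
      rw [mem_sphere_zero_iff_norm, norm_smul, norm_inv, norm_norm, inv_mul_cancel₀ hpos.ne'])
    rw [hf _ (inv_nonneg.2 hpos.le)] at hunit
    exact nonpos_of_mul_nonpos_right hunit (inv_pos.2 hpos)

variable {p q : V → ℝ} {γ : ℝ≥0} {s : Set V}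

theorem IsSublinear.le_mul_norm (hp : IsSublinear p) {K : ℝ} (h : ∀ v ∈ sphere (0 : V) 1, p v ≤ K)
    (v : V) : p v ≤ K * ‖v‖ := by
  refine sub_nonpos.1 (nonpos_of_nonpos_on_sphere (f := fun v => p v - K * ‖v‖)
    (fun c hc v => ?_) (fun v hv => ?_) v)
  · rw [hp.map_smul hc, norm_smul, Real.norm_of_nonneg hc]
    ring
  · rw [mem_sphere_zero_iff_norm.1 hv, mul_one]
    exact sub_nonpos.2 (h v hv)

theorem IsSublinear.le_mul_norm_of_isCover [FiniteDimensional ℝ V] (hp : IsSublinear p)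
    (hpc : Continuous p) (hs : IsCover γ (sphere 0 1) s) (hγ : γ < 1) {K : ℝ}
    (hK : ∀ c ∈ s, p c ≤ K) (v : V) : p v ≤ K / (1 - γ) * ‖v‖ := by
  refine hp.le_mul_norm (fun v hv => ?_) v
  obtain ⟨m, hm, hmax⟩ := (isCompact_sphere (0 : V) 1).exists_isMaxOn ⟨v, hv⟩ hpc.continuousOn
  obtain ⟨c, hc, hmc⟩ := hs hm
  have hnorm : ‖m - c‖ ≤ γ := by
    rw [← dist_eq_norm]
    exact_mod_cast hmc
  have hneg := hp.map_add_le m (-m)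
  have hzero := hp.map_smul le_rfl m
  rw [zero_smul, zero_mul] at hzero
  rw [add_neg_cancel, hzero] at hneg
  have hneg' : p (-m) ≤ p m := hmax (by simpa using hm)
  have hpm : p m ≤ K + p m * γ := by
    calc p m ≤ p c + p (m - c) := hp.le_add_sub m c
      _ ≤ K + p m * ‖m - c‖ := add_le_add (hK c hc) (hp.le_mul_norm (fun _ hw => hmax hw) _)
      _ ≤ K + p m * γ := by
        gcongr
        linarith
  have hγ' : (γ : ℝ) < 1 := hγ
  rw [le_div_iff₀ (sub_pos.2 hγ')]
  have : p v ≤ p m := hmax hv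
  nlinarith

theorem IsSublinear.le_mul_norm_of_abs_sub_le [FiniteDimensional ℝ V] (hq : IsSublinear q)
    (hqc : Continuous q) {b ε : ℝ} (hb : ∀ v, p v ≤ b * ‖v‖) (hb0 : 0 ≤ b) (hε0 : 0 ≤ ε)
    (hε : ε ≤ 1 / 2) (hs : s ⊆ sphere 0 1) (hcov : IsCover γ (sphere 0 1) s)
    (hγ : (γ : ℝ) ≤ 1 / 12) (hgood : ∀ c ∈ s, |q c - p c| ≤ ε / 2 * p c) (v : V) :
    q v ≤ 15 / 11 * b * ‖v‖ := by
  refine (hq.le_mul_norm_of_isCover hqc hcov (K := 5 / 4 * b) ?_ (fun c hc => ?_) v).trans ?_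
  · rw [← NNReal.coe_lt_coe, NNReal.coe_one]
    linarith
  · have hbc := hb c
    rw [mem_sphere_zero_iff_norm.1 (hs hc), mul_one] at hbc
    nlinarith [(abs_le.1 (hgood c hc)).2]
  · gcongr
    rw [div_le_iff₀ (by linarith)]
    nlinarith

theorem IsSublinear.abs_sub_le_of_isCover [FiniteDimensional ℝ V] (hp : IsSublinear p)
    (hq : IsSublinear q) (hqc : Continuous q) {a b ε : ℝ} (ha : ∀ v, a * ‖v‖ ≤ p v)
    (hb : ∀ v, p v ≤ b * ‖v‖) (hb0 : 0 < b) (hε0 : 0 ≤ ε) (hε : ε ≤ 1 / 2)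
    (hs : s ⊆ sphere 0 1) (hcov : IsCover γ (sphere 0 1) s) (hγ : 6 * (b * γ) ≤ ε * a)
    (hgood : ∀ c ∈ s, |q c - p c| ≤ ε / 2 * p c) (v : V) : |q v - p v| ≤ ε * p v := by
  refine sub_nonpos.1 (nonpos_of_nonpos_on_sphere (f := fun v => |q v - p v| - ε * p v)
    (fun c hc v => ?_) (fun v hv => sub_nonpos.2 ?_) v)
  · rw [hp.map_smul hc, hq.map_smul hc, ← mul_sub, abs_mul, abs_of_nonneg hc]
    ring
  have hav := ha v
  have hbv := hb v
  rw [mem_sphere_zero_iff_norm.1 hv, mul_one] at hav hbv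
  have hγ1 : (γ : ℝ) ≤ 1 / 12 := by
    refine le_of_mul_le_mul_left (?_ : b * γ ≤ b * (1 / 12)) hb0
    nlinarith
  have hq_le := hq.le_mul_norm_of_abs_sub_le hqc hb hb0.le hε0 hε hs hcov hγ1 hgood
  obtain ⟨c, hc, hvc⟩ := hcov hv
  have hnorm : ‖v - c‖ ≤ γ := by
    rw [← dist_eq_norm]
    exact_mod_cast hvc
  have hnorm' : ‖c - v‖ ≤ γ := by rwa [norm_sub_rev]
  have hbγ : b * γ ≤ ε * p v / 6 := by nlinarith
  have hp_sub {w : V} (hw : ‖w‖ ≤ γ) : p w ≤ ε * p v / 6 :=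
    (hb w).trans ((mul_le_mul_of_nonneg_left hw hb0.le).trans hbγ)
  have hq_sub {w : V} (hw : ‖w‖ ≤ γ) : q w ≤ 15 / 66 * (ε * p v) := by
    have := (hq_le w).trans (mul_le_mul_of_nonneg_left hw (by positivity))
    linarith
  have hpc_le : ε * p c ≤ ε * (p v + ε * p v / 6) :=
    mul_le_mul_of_nonneg_left ((hp.le_add_sub c v).trans (add_le_add le_rfl (hp_sub hnorm'))) hε0
  have hεp : ε * (ε * p v) ≤ 1 / 2 * (ε * p v) := by
    refine mul_le_mul_of_nonneg_right hε ?_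
    have : 0 ≤ b * (γ : ℝ) := by positivity
    linarith
  have hgoodc := abs_le.1 (hgood c hc)
  rw [abs_le]
  constructor
  · linarith [hq.le_add_sub c v, hp.le_add_sub v c, hp_sub hnorm, hq_sub hnorm']
  · linarith [hq.le_add_sub v c, hp.le_add_sub c v, hp_sub hnorm', hq_sub hnorm]

end Sublinear

/-! ### The quantile loss -/

section Loss

variable {n : ℕ} {τ : ℝ}

theorem rho_eq_max (z : ℝ) : rho τ z = max (τ * z) ((τ - 1) * z) := by
  rw [rho]
  split_ifs with h
  · rw [max_eq_left (by linarith)]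
  · rw [max_eq_right (by linarith)]

theorem isSublinear_rho : IsSublinear (rho τ) where
  map_add_le y z := by
    simp only [rho_eq_max, mul_add]
    exact max_add_add_le_max_add_max
  map_smul hc z := by
    rw [smul_eq_mul, rho_eq_max, rho_eq_max, mul_max_of_nonneg _ _ hc, mul_left_comm,
      mul_left_comm (τ - 1)]

theorem rho_le (hτ : 1 / 2 ≤ τ) (z : ℝ) : rho τ z ≤ τ * |z| := by
  rw [rho]
  split_ifs with h
  · rw [abs_of_nonneg h]
  · rw [abs_of_neg (not_le.1 h)]
    nlinarith

theorem le_rho (hτ : 1 / 2 ≤ τ) (z : ℝ) : (1 - τ) * |z| ≤ rho τ z := by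
  rw [rho]
  split_ifs with h
  · rw [abs_of_nonneg h]
    exact mul_le_mul_of_nonneg_right (by linarith) h
  · rw [abs_of_neg (not_le.1 h)]
    linarith

theorem rho_nonneg (hτ : 1 / 2 ≤ τ) (hτ1 : τ < 1) (z : ℝ) : 0 ≤ rho τ z :=
  (mul_nonneg (by linarith) (abs_nonneg z)).trans (le_rho hτ z)

theorem isSublinear_quantileLoss : IsSublinear (quantileLoss τ : (Fin n → ℝ) → ℝ) where
  map_add_le y z := by
    simp only [quantileLoss, ← Finset.sum_add_distrib]
    exact Finset.sum_le_sum fun i _ => isSublinear_rho.map_add_le _ _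
  map_smul hc z := by
    simp only [quantileLoss, Finset.mul_sum]
    exact Finset.sum_congr rfl fun i _ => isSublinear_rho.map_smul hc _

theorem continuous_quantileLoss : Continuous (quantileLoss τ : (Fin n → ℝ) → ℝ) := by
  unfold quantileLoss
  simp only [rho_eq_max]
  fun_prop

theorem quantileLoss_le (hτ : 1 / 2 ≤ τ) (z : Fin n → ℝ) : quantileLoss τ z ≤ τ * ∑ i, |z i| := by
  rw [quantileLoss, Finset.mul_sum]
  exact Finset.sum_le_sum fun i _ => rho_le hτ _

theorem le_quantileLoss (hτ : 1 / 2 ≤ τ) (z : Fin n → ℝ) :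
    (1 - τ) * ∑ i, |z i| ≤ quantileLoss τ z := by
  rw [quantileLoss, Finset.mul_sum]
  exact Finset.sum_le_sum fun i _ => le_rho hτ _

open Metric in
theorem abs_quantileLoss_mulVec_sub_le_of_isCover {ε : ℝ} (hτ : 1 / 2 ≤ τ) (hε0 : 0 ≤ ε)
    (hε : ε ≤ 1 / 2) (S : Matrix (Fin n) (Fin n) ℝ)
    (V : Submodule ℝ (PiLp 1 fun _ : Fin n => ℝ)) {γ : NNReal} {s : Set V}
    (hs : s ⊆ sphere 0 1) (hcov : IsCover γ (sphere 0 1) s) (hγ : 6 * (τ * γ) ≤ ε * (1 - τ))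
    (hgood : ∀ z ∈ s, |quantileLoss τ (S.mulVec z.1.ofLp) - quantileLoss τ z.1.ofLp| ≤
      ε / 2 * quantileLoss τ z.1.ofLp) (z : V) :
    |quantileLoss τ (S.mulVec z.1.ofLp) - quantileLoss τ z.1.ofLp| ≤
      ε * quantileLoss τ z.1.ofLp := by
  set L : V →ₗ[ℝ] (Fin n → ℝ) := (WithLp.linearEquiv 1 ℝ (Fin n → ℝ)).toLinearMap ∘ₗ V.subtype
  have hL (z : V) : ‖z‖ = ∑ i, |L z i| := by
    rw [Submodule.coe_norm, PiLp.norm_eq_of_L1]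
    rfl
  refine (isSublinear_quantileLoss.comp L).abs_sub_le_of_isCover
    (isSublinear_quantileLoss.comp (S.mulVecLin ∘ₗ L))
    (continuous_quantileLoss.comp (S.mulVecLin ∘ₗ L).continuous_of_finiteDimensional)
    (fun z => ?_) (fun z => ?_) (by linarith) hε0 hε hs hcov hγ hgood z
  · rw [hL]
    exact le_quantileLoss hτ _
  · rw [hL]
    exact quantileLoss_le hτ _

end Loss

/-! ### Conditioning and the sample size -/

section Conditioning

variable {n d : ℕ} {U : Matrix (Fin n) (Fin d) ℝ} {α β κ ε τ : ℝ}

theorem IsConditioned.abs_mulVec_le (h : IsConditioned α β U) (x : Fin d → ℝ) (i : Fin n) :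
    |U.mulVec x i| ≤ (∑ j, |U i j|) * (β * ∑ i, |U.mulVec x i|) := by
  calc |U.mulVec x i| ≤ ∑ j, |U i j * x j| :=
        Finset.abs_sum_le_sum_abs (fun j => U i j * x j) Finset.univ
    _ ≤ ∑ j, |U i j| * ‖x‖ := by
        refine Finset.sum_le_sum fun j _ => ?_
        rw [abs_mul]
        exact mul_le_mul_of_nonneg_left (norm_le_pi_norm x j) (abs_nonneg _)
    _ = (∑ j, |U i j|) * ‖x‖ := (Finset.sum_mul _ _ _).symm
    _ ≤ _ := mul_le_mul_of_nonneg_left (h.2 x) (Finset.sum_nonneg fun j _ => abs_nonneg _)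

theorem IsConditioned.one_le_mul_sum (h : IsConditioned α β U) (j : Fin d) :
    1 ≤ β * ∑ i, |U i j| := by
  simpa [Pi.norm_single] using h.2 (Pi.single j 1)

theorem IsConditioned.right_pos (h : IsConditioned α β U) (hd : 0 < d) : 0 < β :=
  pos_of_mul_pos_left (one_pos.trans_le (h.one_le_mul_sum ⟨0, hd⟩))
    (Finset.sum_nonneg fun _ _ => abs_nonneg _)

theorem IsConditioned.dim_le_mul (h : IsConditioned α β U) (hd : 0 < d) : (d : ℝ) ≤ α * β := by
  calc (d : ℝ) = ∑ _j : Fin d, (1 : ℝ) := by simp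
    _ ≤ ∑ j, β * ∑ i, |U i j| := Finset.sum_le_sum fun j _ => h.one_le_mul_sum j
    _ = (∑ i, ∑ j, |U i j|) * β := by rw [← Finset.mul_sum, Finset.sum_comm, mul_comm]
    _ ≤ α * β := mul_le_mul_of_nonneg_right h.1 (h.right_pos hd).le

theorem IsConditioned.one_le_mul (h : IsConditioned α β U) (hd : 0 < d) : 1 ≤ α * β :=
  (Nat.one_le_cast.2 hd).trans (h.dim_le_mul hd)

theorem IsConditioned.card_pos (h : IsConditioned α β U) (hd : 0 < d) : 0 < n := by
  rcases Nat.eq_zero_or_pos n with rfl | hn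
  · have := h.one_le_mul_sum ⟨0, hd⟩
    simp only [Finset.univ_eq_empty, Finset.sum_empty, mul_zero] at this
    linarith
  · exact hn

theorem IsConditionNumber.dim_pos (h : IsConditionNumber U κ) : 0 < d := by
  rcases Nat.eq_zero_or_pos d with rfl | hd
  · have hmem : κ - 1 ∈ {c : ℝ | ∃ α β : ℝ, IsConditioned α β U ∧ c = α * β} :=
      ⟨1, κ - 1, ⟨by simp, fun x => by simp [Subsingleton.elim x 0]⟩, (one_mul _).symm⟩
    linarith [h.2 hmem]
  · exact hd

theorem IsConditioned.rho_mulVec_le (h : IsConditioned α β U) (hβ : 0 ≤ β) (hτ : 1 / 2 ≤ τ)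
    (hτ1 : τ < 1) (x : Fin d → ℝ) (i : Fin n) :
    rho τ (U.mulVec x i) ≤
      τ / (1 - τ) * β * quantileLoss τ (U.mulVec x) * ∑ j, |U i j| := by
  have : 0 ≤ τ := by linarith
  have hnorm : ∑ k, |U.mulVec x k| ≤ quantileLoss τ (U.mulVec x) / (1 - τ) := by
    rw [le_div_iff₀' (sub_pos.2 hτ1)]
    exact le_quantileLoss hτ _
  calc rho τ (U.mulVec x i) ≤ τ * |U.mulVec x i| := rho_le hτ _
    _ ≤ τ * ((∑ j, |U i j|) * (β * ∑ k, |U.mulVec x k|)) := by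
        gcongr
        exact h.abs_mulVec_le x i
    _ ≤ τ * ((∑ j, |U i j|) * (β * (quantileLoss τ (U.mulVec x) / (1 - τ)))) := by gcongr
    _ = _ := by ring

theorem one_le_odds (hτ : 1 / 2 ≤ τ) (hτ1 : τ < 1) : 1 ≤ τ / (1 - τ) := by
  rw [one_le_div₀ (sub_pos.2 hτ1)]
  linarith

theorem two_lt_odds_div (hε0 : 0 < ε) (hε : ε < 1 / 2) (hτ : 1 / 2 ≤ τ) (hτ1 : τ < 1) :
    2 < τ / (1 - τ) / ε := by
  rw [lt_div_iff₀ hε0]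
  linarith [one_le_odds hτ hτ1]

/-- The logarithmic factor `d log (18 μ / ε) + log 80` of the sampling complexity: the logarithm of
`80` times the cardinality of a net. -/
noncomputable def logFactor (d : ℕ) (ε τ : ℝ) : ℝ :=
  d * Real.log (τ / (1 - τ) * (18 / ε)) + Real.log 80

theorem sampleSize_eq : sampleSize d κ ε τ = τ / (1 - τ) * (81 * κ / ε ^ 2) * logFactor d ε τ := rfl

theorem exp_neg_logFactor (hε0 : 0 < ε) (hτ : 1 / 2 ≤ τ) (hτ1 : τ < 1) :
    Real.exp (-logFactor d ε τ) = ((τ / (1 - τ) * (18 / ε)) ^ d)⁻¹ / 80 := by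
  have : 0 < τ / (1 - τ) := one_pos.trans_le (one_le_odds hτ hτ1)
  rw [logFactor, neg_add, Real.exp_add, Real.exp_neg, Real.exp_neg, Real.exp_log (by norm_num),
    ← Real.log_pow, Real.exp_log (by positivity), ← div_eq_mul_inv]

theorem logFactor_pos (hε0 : 0 < ε) (hε : ε < 1 / 2) (hτ : 1 / 2 ≤ τ) (hτ1 : τ < 1) :
    0 < logFactor d ε τ := by
  have hlog : 0 ≤ Real.log (τ / (1 - τ) * (18 / ε)) := by
    apply Real.log_nonneg
    rw [mul_div_left_comm]
    linarith [two_lt_odds_div hε0 hε hτ hτ1]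
  exact add_pos_of_nonneg_of_pos (by positivity) (Real.log_pos (by norm_num))

theorem sampleSize_pos (hκ : 0 < κ) (hε0 : 0 < ε) (hε : ε < 1 / 2) (hτ : 1 / 2 ≤ τ) (hτ1 : τ < 1) :
    0 < sampleSize d κ ε τ := by
  have hL := logFactor_pos (d := d) hε0 hε hτ hτ1
  have := one_le_odds hτ hτ1
  rw [sampleSize_eq]
  positivity

theorem logFactor_le (hd : 0 < d) (hε0 : 0 < ε) (hε : ε < 1 / 2) (hτ : 1 / 2 ≤ τ) (hτ1 : τ < 1) :
    logFactor d ε τ ≤ 13 * (d * Real.log (τ / (1 - τ) / ε)) := by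
  have h2 := two_lt_odds_div hε0 hε hτ hτ1
  set l := Real.log (τ / (1 - τ) / ε)
  have hlog2 : Real.log 2 ≤ l := Real.log_le_log two_pos h2.le
  have hlog_le {a : ℝ} (ha : 0 < a) {m : ℕ} (ham : a ≤ 2 ^ m) : Real.log a ≤ m * l :=
    calc Real.log a ≤ Real.log (2 ^ m) := Real.log_le_log ha ham
      _ = m * Real.log 2 := Real.log_pow 2 m
      _ ≤ m * l := by gcongr
  have h18 := hlog_le (a := 18) (m := 5) (by norm_num) (by norm_num)
  have h80 := hlog_le (a := 80) (m := 7) (by norm_num) (by norm_num)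
  push_cast at h18 h80
  have hd1 : (1 : ℝ) ≤ d := Nat.one_le_cast.2 hd
  have hl : 0 ≤ l := (Real.log_nonneg one_le_two).trans hlog2
  calc logFactor d ε τ = d * (Real.log 18 + l) + Real.log 80 := by
        rw [logFactor, mul_div_left_comm, Real.log_mul (by norm_num) (by positivity)]
    _ ≤ d * (5 * l + l) + d * (7 * l) := by
        gcongr
        exact h80.trans (le_mul_of_one_le_left (by positivity) hd1)
    _ = 13 * (d * l) := by ring

theorem sampleSize_le (hd : 0 < d) (hκ : 0 ≤ κ) (hε0 : 0 < ε) (hε : ε < 1 / 2) (hτ : 1 / 2 ≤ τ)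
    (hτ1 : τ < 1) : sampleSize d κ ε τ ≤
      1053 * (τ / (1 - τ) * κ * d * Real.log (τ / (1 - τ) / ε) / ε ^ 2) := by
  have := one_le_odds hτ hτ1
  calc sampleSize d κ ε τ
      ≤ τ / (1 - τ) * (81 * κ / ε ^ 2) * (13 * (d * Real.log (τ / (1 - τ) / ε))) := by
        rw [sampleSize_eq]
        gcongr
        exact logFactor_le hd hε0 hε hτ hτ1
    _ = _ := by ring

end Conditioning

/-! ### The sampling probabilities -/

section KeepProb

variable {n d r : ℕ} (hr : 0 < r) (A : Matrix (Fin n) (Fin d) ℝ) (R : Matrix (Fin d) (Fin d) ℝ)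
  {κ ε τ : ℝ}

include hr in
theorem rowEstimate_nonneg (G : Matrix (Fin d) (Fin r) ℝ) (i : Fin n) :
    0 ≤ rowEstimate A R G i := by
  by_contra! h
  have hle := le_two_mul_card_of_median_lt hr h
  rw [Finset.filter_eq_empty_iff.2 fun l _ => not_lt.2 (abs_nonneg _), Finset.card_empty] at hle
  omega

theorem keepProb_le_one (G : Matrix (Fin d) (Fin r) ℝ) (i : Fin n) : keepProb A R κ ε τ G i ≤ 1 :=
  min_le_left _ _

include hr in
theorem keepProb_nonneg (G : Matrix (Fin d) (Fin r) ℝ) (hs : 0 ≤ sampleSize d κ ε τ) (i : Fin n) :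
    0 ≤ keepProb A R κ ε τ G i :=
  le_min zero_le_one (mul_nonneg hs (div_nonneg (rowEstimate_nonneg hr A R G i)
    (Finset.sum_nonneg fun k _ => rowEstimate_nonneg hr A R G k)))

theorem sum_keepProb_le (G : Matrix (Fin d) (Fin r) ℝ) (hs : 0 ≤ sampleSize d κ ε τ) :
    ∑ i, keepProb A R κ ε τ G i ≤ sampleSize d κ ε τ := by
  calc ∑ i, keepProb A R κ ε τ G i
      ≤ ∑ i, sampleSize d κ ε τ * (rowEstimate A R G i / ∑ k, rowEstimate A R G k) :=
        Finset.sum_le_sum fun i _ => min_le_right _ _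
    _ = sampleSize d κ ε τ * ((∑ k, rowEstimate A R G k) / ∑ k, rowEstimate A R G k) := by
        rw [← Finset.mul_sum, Finset.sum_div]
    _ ≤ _ := mul_le_of_le_one_right hs (div_self_le_one _)

theorem numSampled_samplingMatrix (ω : Seed n d r) :
    numSampled (samplingMatrix A R κ ε τ ω) =
      (Finset.univ.filter fun i => (ω.2 i : ℝ) < keepProb A R κ ε τ (Matrix.of ω.1) i).card := by
  simp only [numSampled, samplingMatrix_ne_zero_iff]

theorem quantileLoss_samplingMatrix_mulVec (ω : Seed n d r) (z : Fin n → ℝ) :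
    quantileLoss τ ((samplingMatrix A R κ ε τ ω).mulVec z) =
      horvitzThompson (keepProb A R κ ε τ (Matrix.of ω.1)) (fun i => rho τ (z i)) ω.2 := by
  refine Finset.sum_congr rfl fun i _ => ?_
  rw [samplingMatrix, Matrix.mulVec_diagonal]
  split_ifs with h
  · have hp : 0 < keepProb A R κ ε τ (Matrix.of ω.1) i := (ω.2 i).2.1.trans_lt h
    rw [← smul_eq_mul, isSublinear_rho.map_smul (one_div_pos.2 hp).le, one_div_mul_eq_div]
  · simp [rho]

variable {A R} {G : Fin d → Fin r → ℝ}

include hr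

theorem GoodEstimates.mul_sum_abs_le (hG : GoodEstimates A R G) (hs : 0 ≤ sampleSize d κ ε τ)
    {i : Fin n} (hi : keepProb A R κ ε τ (Matrix.of G) i < 1) :
    81 / 400 * sampleSize d κ ε τ * ∑ j, |(A * R⁻¹) i j| ≤
      keepProb A R κ ε τ (Matrix.of G) i * ∑ i, ∑ j, |(A * R⁻¹) i j| := by
  set lam := rowEstimate A R (Matrix.of G)
  have hp0 := keepProb_nonneg hr A R (Matrix.of G) hs i
  have hsum : ∑ k, lam k ≤ 20 / 9 * ∑ i, ∑ j, |(A * R⁻¹) i j| := by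
    rw [Finset.mul_sum]
    exact Finset.sum_le_sum fun k _ => (hG k).2
  have hp : keepProb A R κ ε τ (Matrix.of G) i = sampleSize d κ ε τ * (lam i / ∑ k, lam k) :=
    min_eq_right ((min_lt_iff.1 hi).resolve_left (lt_irrefl _)).le
  have hcancel : lam i / (∑ k, lam k) * ∑ k, lam k = lam i :=
    div_mul_cancel_of_imp fun h =>
      (Finset.sum_eq_zero_iff_of_nonneg fun k _ => rowEstimate_nonneg hr A R _ k).1 h i
        (Finset.mem_univ i)
  calc 81 / 400 * sampleSize d κ ε τ * ∑ j, |(A * R⁻¹) i j|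
      = 9 / 20 * (sampleSize d κ ε τ * (9 / 20 * ∑ j, |(A * R⁻¹) i j|)) := by ring
    _ ≤ 9 / 20 * (sampleSize d κ ε τ * lam i) := by
        gcongr
        exact (hG i).1
    _ = keepProb A R κ ε τ (Matrix.of G) i * (9 / 20 * ∑ k, lam k) := by
        rw [hp]
        linear_combination -(9 / 20 * sampleSize d κ ε τ) * hcancel
    _ ≤ keepProb A R κ ε τ (Matrix.of G) i * ∑ i, ∑ j, |(A * R⁻¹) i j| := by
        gcongr
        linarith

theorem GoodEstimates.rho_mulVec_le_mul_keepProb {α β : ℝ} (hG : GoodEstimates A R G) (hd : 0 < d)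
    (hU : IsConditioned α β (A * R⁻¹)) (hκ : α * β ≤ κ) (hε0 : 0 < ε) (hε : ε < 1 / 2)
    (hτ : 1 / 2 ≤ τ) (hτ1 : τ < 1) (x : Fin d → ℝ) {i : Fin n}
    (hi : keepProb A R κ ε τ (Matrix.of G) i < 1) :
    rho τ ((A * R⁻¹).mulVec x i) ≤
      ε ^ 2 / (16 * logFactor d ε τ) * quantileLoss τ ((A * R⁻¹).mulVec x) *
        keepProb A R κ ε τ (Matrix.of G) i := by
  have hL := logFactor_pos (d := d) hε0 hε hτ hτ1
  have hβ := hU.right_pos hd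
  have hκ0 : 0 < κ := by linarith [hU.one_le_mul hd]
  have hs := sampleSize_pos (d := d) hκ0 hε0 hε hτ hτ1
  have hp := keepProb_nonneg hr A R (Matrix.of G) hs.le i
  have hle := hG.mul_sum_abs_le hr hs.le hi
  have hc : 0 ≤ ∑ j, |(A * R⁻¹) i j| := Finset.sum_nonneg fun _ _ => abs_nonneg _
  have hQ : 0 ≤ quantileLoss τ ((A * R⁻¹).mulVec x) :=
    Finset.sum_nonneg fun i _ => rho_nonneg hτ hτ1 _
  have := one_le_odds hτ hτ1
  rw [sampleSize_eq] at hle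
  set L := logFactor d ε τ
  set p := keepProb A R κ ε τ (Matrix.of G) i
  set c := ∑ j, |(A * R⁻¹) i j|
  have hkey : κ * (τ / (1 - τ) * β * c) ≤ κ * (ε ^ 2 / (16 * L) * p) :=
    calc κ * (τ / (1 - τ) * β * c) = ε ^ 2 / (16 * L) *
          (β * (16 / 81 * (τ / (1 - τ) * (81 * κ / ε ^ 2) * L) * c)) := by field_simp
      _ ≤ ε ^ 2 / (16 * L) * (β * (81 / 400 * (τ / (1 - τ) * (81 * κ / ε ^ 2) * L) * c)) := by
        gcongr _ * (_ * (?_ * _ * _))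
        norm_num
      _ ≤ ε ^ 2 / (16 * L) * (β * (p * α)) := by
        gcongr _ * (_ * ?_)
        exact hle.trans (mul_le_mul_of_nonneg_left hU.1 hp)
      _ = ε ^ 2 / (16 * L) * p * (α * β) := by ring
      _ ≤ ε ^ 2 / (16 * L) * p * κ := by gcongr
      _ = κ * (ε ^ 2 / (16 * L) * p) := mul_comm _ _
  calc rho τ ((A * R⁻¹).mulVec x i)
      ≤ τ / (1 - τ) * β * quantileLoss τ ((A * R⁻¹).mulVec x) * c :=
        hU.rho_mulVec_le hβ.le hτ hτ1 x i
    _ = quantileLoss τ ((A * R⁻¹).mulVec x) * (τ / (1 - τ) * β * c) := by ring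
    _ ≤ quantileLoss τ ((A * R⁻¹).mulVec x) * (ε ^ 2 / (16 * L) * p) :=
        mul_le_mul_of_nonneg_left (le_of_mul_le_mul_left hkey hκ0) hQ
    _ = _ := by ring

end KeepProb

/-! ### Probabilities of events -/

theorem one_sub_le_measureReal_of_compl_subset {Ω : Type*} [MeasurableSpace Ω] {μ : Measure Ω}
    [IsProbabilityMeasure μ] {E B : Set Ω} {c : ℝ} (h : Eᶜ ⊆ B) (hB : μ.real B ≤ c) :
    1 - c ≤ μ.real E := by
  have hcover : E ∪ B = Set.univ := Set.compl_subset_iff_union.1 h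
  have hone := measureReal_union_le (μ := μ) E B
  rw [hcover, probReal_univ] at hone
  linarith

section Seed

variable {n d r : ℕ}

instance : IsProbabilityMeasure (seedLaw n d r) := by
  unfold seedLaw
  infer_instance

theorem seedLaw_real_le {E : Set (Seed n d r)} (hE : MeasurableSet E) {c : ℝ} (hc : 0 ≤ c)
    (h : ∀ g : Fin d → Fin r → ℝ,
      (Measure.pi fun _ : Fin n => (volume : Measure unitInterval)).real {u | (g, u) ∈ E} ≤ c) :
    (seedLaw n d r).real E ≤ c := by
  refine ENNReal.toReal_le_of_le_ofReal hc ?_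
  rw [seedLaw, Measure.prod_apply hE]
  calc _ ≤ ∫⁻ _ : Fin d → Fin r → ℝ, ENNReal.ofReal c ∂(cauchyLaw (Fin d) (Fin r)) := by
        refine lintegral_mono fun g => ?_
        rw [← ENNReal.ofReal_toReal (measure_ne_top _ (Prod.mk g ⁻¹' E))]
        exact ENNReal.ofReal_le_ofReal (h g)
    _ = ENNReal.ofReal c := by simp

theorem seedLaw_real_fst (P : Set (Fin d → Fin r → ℝ)) :
    (seedLaw n d r).real {ω | ω.1 ∈ P} = (cauchyLaw (Fin d) (Fin r)).real P := by
  have hprod : {ω : Seed n d r | ω.1 ∈ P} = P ×ˢ Set.univ := by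
    ext
    simp
  rw [hprod, seedLaw, measureReal_prod_prod, probReal_univ, mul_one]

variable (hr : 0 < r) (A : Matrix (Fin n) (Fin d) ℝ) (R : Matrix (Fin d) (Fin d) ℝ) {κ ε τ : ℝ}
include hr

theorem measurableSet_goodEstimates :
    MeasurableSet {G : Fin d → Fin r → ℝ | GoodEstimates A R G} := by
  simp only [GoodEstimates, Set.ofPred_forall]
  exact MeasurableSet.iInter fun i => measurable_rowEstimate A R hr i measurableSet_Icc

theorem measurableSet_coe_lt_keepProb (i : Fin n) :
    MeasurableSet {ω : Seed n d r | (ω.2 i : ℝ) < keepProb A R κ ε τ (Matrix.of ω.1) i} :=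
  measurableSet_lt (measurable_subtype_coe.comp ((measurable_pi_apply i).comp measurable_snd))
    ((measurable_keepProb A R hr κ ε τ i).comp measurable_fst)

theorem measurable_numSampled :
    Measurable fun ω : Seed n d r => numSampled (samplingMatrix A R κ ε τ ω) := by
  simp only [numSampled_samplingMatrix, Finset.card_filter]
  exact Finset.measurable_sum _ fun i _ =>
    Measurable.ite (measurableSet_coe_lt_keepProb hr A R i) measurable_const measurable_const

theorem measurable_quantileLoss_samplingMatrix_mulVec (z : Fin n → ℝ) :
    Measurable fun ω : Seed n d r =>
      quantileLoss τ ((samplingMatrix A R κ ε τ ω).mulVec z) := by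
  simp only [quantileLoss_samplingMatrix_mulVec, horvitzThompson]
  exact Finset.measurable_sum _ fun i _ =>
    Measurable.ite (measurableSet_coe_lt_keepProb hr A R i)
      (((measurable_keepProb A R hr κ ε τ i).comp measurable_fst).const_div _) measurable_const

theorem seedLaw_real_le_numSampled_le (hs : 0 ≤ sampleSize d κ ε τ) (T : ℝ) :
    (seedLaw n d r).real {ω | T ≤ numSampled (samplingMatrix A R κ ε τ ω)} ≤
      Real.exp (sampleSize d κ ε τ - T * Real.log 2) := by
  refine seedLaw_real_le (measurableSet_le measurable_const
    (measurable_from_nat.comp (measurable_numSampled hr A R))) (Real.exp_pos _).le fun g => ?_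
  set p := keepProb A R κ ε τ (Matrix.of g)
  have hvol (i) : (volume : Measure unitInterval).real {u | (u : ℝ) < p i} = p i :=
    volume_real_coe_lt (keepProb_nonneg hr A R _ hs i) (keepProb_le_one A R _ i)
  simp only [numSampled_samplingMatrix, Set.mem_ofPred_eq]
  refine (measureReal_pi_le_card_le (volume : Measure unitInterval)
    (s := fun i => {u : unitInterval | (u : ℝ) < p i}) (fun i => measurableSet_coe_lt (p i))
    one_le_two T).trans ?_
  calc (∏ i, (1 + (2 - 1) * (volume : Measure unitInterval).real {u | (u : ℝ) < p i})) / 2 ^ T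
      ≤ (∏ i, Real.exp (p i)) / 2 ^ T := by
        gcongr with i
        rw [hvol]
        linarith [Real.add_one_le_exp (p i)]
    _ = Real.exp (∑ i, p i - T * Real.log 2) := by
        rw [← Real.exp_sum, Real.exp_sub, Real.rpow_def_of_pos two_pos, mul_comm T]
    _ ≤ _ := Real.exp_le_exp.2 (sub_le_sub_right (sum_keepProb_le A R _ hs) _)

variable {α β : ℝ} (hd : 0 < d) (hU : IsConditioned α β (A * R⁻¹)) (hκ : α * β ≤ κ) (hε0 : 0 < ε)
  (hε : ε < 1 / 2) (hτ : 1 / 2 ≤ τ) (hτ1 : τ < 1)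
include hd hU hκ hε0 hε hτ hτ1

theorem seedLaw_real_deviation_le {x : Fin d → ℝ}
    (hx : 0 < quantileLoss τ ((A * R⁻¹).mulVec x)) :
    (seedLaw n d r).real {ω | GoodEstimates A R ω.1 ∧
      ε / 2 * quantileLoss τ ((A * R⁻¹).mulVec x) <
        |quantileLoss τ ((samplingMatrix A R κ ε τ ω).mulVec ((A * R⁻¹).mulVec x)) -
          quantileLoss τ ((A * R⁻¹).mulVec x)|} ≤ 2 * Real.exp (-logFactor d ε τ) := by
  set z := (A * R⁻¹).mulVec x
  have hdev := measurable_quantileLoss_samplingMatrix_mulVec hr A R (κ := κ) (ε := ε) (τ := τ) z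
  refine seedLaw_real_le ?_ (by positivity) fun g => ?_
  · exact ((measurableSet_goodEstimates hr A R).preimage measurable_fst).inter
      (measurableSet_lt measurable_const (hdev.sub_const _).abs)
  simp only [quantileLoss_samplingMatrix_mulVec, Set.mem_ofPred_eq]
  by_cases hg : GoodEstimates A R g
  · have hL := logFactor_pos (d := d) hε0 hε hτ hτ1
    have hs := sampleSize_pos (d := d) (κ := κ) (by linarith [hU.one_le_mul hd]) hε0 hε hτ hτ1
    have h := measureReal_lt_abs_horvitzThompson_sub_le (w := fun i => rho τ (z i)) (t := ε / 2)
      (keepProb_nonneg hr A R (Matrix.of g) hs.le) (keepProb_le_one A R (Matrix.of g))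
      (fun i => rho_nonneg hτ hτ1 _)
      (show 0 < ε ^ 2 / (16 * logFactor d ε τ) * quantileLoss τ z by positivity)
      (fun i hi => hg.rho_mulVec_le_mul_keepProb hr hd hU hκ hε0 hε hτ hτ1 x hi)
      (by linarith) (by linarith)
    have hexp : (ε / 2) ^ 2 * quantileLoss τ z /
        (4 * (ε ^ 2 / (16 * logFactor d ε τ) * quantileLoss τ z)) = logFactor d ε τ := by
      field_simp
      norm_num
    rw [show ∑ i, rho τ (z i) = quantileLoss τ z from rfl, hexp] at h
    simpa only [hg, true_and] using h
  · simp only [hg, false_and, Set.ofPred_false, measureReal_empty]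
    positivity

end Seed

/-! ### The distortion bound -/

section Distortion

open Metric Module

variable {n d : ℕ} (A : Matrix (Fin n) (Fin d) ℝ) (R : Matrix (Fin d) (Fin d) ℝ) {κ ε τ : ℝ}

/-- The column space of a matrix, with the `ℓ1` norm. -/
noncomputable def columnSpace (U : Matrix (Fin n) (Fin d) ℝ) :
    Submodule ℝ (PiLp 1 fun _ : Fin n => ℝ) :=
  LinearMap.range ((WithLp.linearEquiv 1 ℝ (Fin n → ℝ)).symm.toLinearMap ∘ₗ U.mulVecLin)

theorem exists_mulVec_eq_of_mem_columnSpace {U : Matrix (Fin n) (Fin d) ℝ}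
    {z : PiLp 1 fun _ : Fin n => ℝ} (hz : z ∈ columnSpace U) : ∃ x, U.mulVec x = z.ofLp := by
  obtain ⟨x, rfl⟩ := hz
  exact ⟨x, rfl⟩

theorem finrank_columnSpace_le (U : Matrix (Fin n) (Fin d) ℝ) : finrank ℝ (columnSpace U) ≤ d :=
  (LinearMap.finrank_range_le _).trans_eq (by simp)

theorem quantileLoss_pos_of_norm_eq_one (hτ : 1 / 2 ≤ τ) (hτ1 : τ < 1)
    {z : PiLp 1 fun _ : Fin n => ℝ} (hz : ‖z‖ = 1) : 0 < quantileLoss τ z.ofLp := by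
  refine lt_of_lt_of_le ?_ (le_quantileLoss hτ _)
  have hsum : ∑ i, |z.ofLp i| = 1 := by
    rw [← hz, PiLp.norm_eq_of_L1]
    rfl
  rw [hsum, mul_one]
  exact sub_pos.2 hτ1

open scoped NNReal in
theorem exists_isCover_columnSpace (U : Matrix (Fin n) (Fin d) ℝ) (hε0 : 0 < ε) (hε : ε < 1 / 2)
    (hτ : 1 / 2 ≤ τ) (hτ1 : τ < 1) :
    ∃ (γ : ℝ≥0) (s : Finset (columnSpace U)), 6 * (τ * γ) ≤ ε * (1 - τ) ∧
      (s : Set (columnSpace U)) ⊆ sphere 0 1 ∧ (s.card : ℝ) ≤ (τ / (1 - τ) * (18 / ε)) ^ d ∧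
      IsCover γ (sphere 0 1) (s : Set (columnSpace U)) := by
  have : 0 < τ := by linarith
  have : 0 < 1 - τ := sub_pos.2 hτ1
  have hγ : 0 < ε * (1 - τ) / (6 * τ) := by positivity
  obtain ⟨s, hs, hcard, hcov⟩ := exists_isCover_sphere (E := columnSpace U)
    (Real.toNNReal_pos.2 hγ)
  rw [Real.coe_toNNReal _ hγ.le] at hcard
  refine ⟨_, s, ?_, hs, hcard.trans ?_, hcov⟩
  · rw [Real.coe_toNNReal _ hγ.le]
    field_simp
    rfl
  calc (1 + 2 / (ε * (1 - τ) / (6 * τ))) ^ finrank ℝ (columnSpace U)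
      ≤ (1 + 2 / (ε * (1 - τ) / (6 * τ))) ^ d :=
        pow_le_pow_right₀ (le_add_of_nonneg_right (by positivity)) (finrank_columnSpace_le U)
    _ = (1 + 12 * (τ / (1 - τ) / ε)) ^ d := by
        congr 2
        field_simp
        norm_num
    _ ≤ (18 * (τ / (1 - τ) / ε)) ^ d := by
        refine pow_le_pow_left₀ (by positivity) ?_ d
        linarith [two_lt_odds_div hε0 hε hτ hτ1]
    _ = (τ / (1 - τ) * (18 / ε)) ^ d := by rw [mul_div_left_comm]

theorem isDistortionEmbedding_of_isCover (hR : IsUnit R.det) (hε0 : 0 ≤ ε) (hε : ε ≤ 1 / 2)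
    (hτ : 1 / 2 ≤ τ) {S : Matrix (Fin n) (Fin n) ℝ} {s : Set (columnSpace (A * R⁻¹))}
    (hs : s ⊆ sphere 0 1) {γ : NNReal} (hcov : IsCover γ (sphere 0 1) s)
    (hγ : 6 * (τ * γ) ≤ ε * (1 - τ))
    (hgood : ∀ z ∈ s, |quantileLoss τ (S.mulVec z.1.ofLp) - quantileLoss τ z.1.ofLp| ≤
      ε / 2 * quantileLoss τ z.1.ofLp) : IsDistortionEmbedding ε τ A S := by
  intro x
  have hAx : A.mulVec x = (A * R⁻¹).mulVec (R.mulVec x) := by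
    rw [Matrix.mulVec_mulVec, Matrix.nonsing_inv_mul_cancel_right _ _ hR]
  have h := abs_quantileLoss_mulVec_sub_le_of_isCover hτ hε0 hε S _ hs hcov hγ hgood
    ⟨WithLp.toLp 1 (A.mulVec x), R.mulVec x, congrArg (WithLp.toLp 1) hAx.symm⟩
  rw [← Matrix.mulVec_mulVec]
  constructor <;> linarith [abs_le.1 h]

variable {α β : ℝ} (hd : 0 < d) (hU : IsConditioned α β (A * R⁻¹)) (hκ : α * β ≤ κ) (hε0 : 0 < ε)
  (hε : ε < 1 / 2) (hτ : 1 / 2 ≤ τ) (hτ1 : τ < 1)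
include hd hU hκ hε0 hε hτ hτ1

theorem seedLaw_real_exists_deviation_le {r : ℕ} (hr : 0 < r)
    {s : Finset (columnSpace (A * R⁻¹))} (hs : (s : Set (columnSpace (A * R⁻¹))) ⊆ sphere 0 1)
    (hcard : (s.card : ℝ) ≤ (τ / (1 - τ) * (18 / ε)) ^ d) :
    (seedLaw n d r).real (⋃ z ∈ s, {ω | GoodEstimates A R ω.1 ∧
      ε / 2 * quantileLoss τ z.1.ofLp <
        |quantileLoss τ ((samplingMatrix A R κ ε τ ω).mulVec z.1.ofLp) -
          quantileLoss τ z.1.ofLp|}) ≤ 1 / 40 := by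
  set q := (τ / (1 - τ) * (18 / ε)) ^ d with hq
  have hq0 : 0 < q := by
    have := one_le_odds hτ hτ1
    positivity
  calc _ ≤ ∑ z ∈ s, 2 * (q⁻¹ / 80) :=
        (measureReal_biUnion_finset_le s _).trans (Finset.sum_le_sum fun z hz => ?_)
    _ = s.card * (2 * (q⁻¹ / 80)) := by rw [Finset.sum_const, nsmul_eq_mul]
    _ ≤ q * (2 * (q⁻¹ / 80)) := by gcongr
    _ = 1 / 40 := by
        field_simp
        norm_num
  have hpos := quantileLoss_pos_of_norm_eq_one hτ hτ1 (mem_sphere_zero_iff_norm.1 (hs hz))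
  obtain ⟨x, hx⟩ := exists_mulVec_eq_of_mem_columnSpace z.2
  rw [← hx] at hpos
  simp only [← hx, hq, ← exp_neg_logFactor hε0 hτ hτ1]
  exact seedLaw_real_deviation_le hr A R hd hU hκ hε0 hε hτ hτ1 hpos

theorem le_measureReal_isDistortionEmbedding (hR : IsUnit R.det) :
    0.9 ≤ (seedLaw n d (numProj n)).real
      {ω | IsDistortionEmbedding ε τ A (samplingMatrix A R κ ε τ ω)} := by
  have hn := hU.card_pos hd
  obtain ⟨γ, s, hγ, hs, hcard, hcov⟩ := exists_isCover_columnSpace (A * R⁻¹) hε0 hε hτ hτ1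
  have hdev := seedLaw_real_exists_deviation_le A R hd hU hκ hε0 hε hτ hτ1 (numProj_pos hn) hs hcard
  have hbad : (seedLaw n d (numProj n)).real {ω | ¬ GoodEstimates A R ω.1} ≤ 1 / 20 :=
    (seedLaw_real_fst {G | ¬ GoodEstimates A R G}).trans_le
      (measureReal_not_goodEstimates_le A R hn)
  refine le_trans (by norm_num) (one_sub_le_measureReal_of_compl_subset
    (Set.compl_subset_comm.1 fun ω hω => ?_)
    ((measureReal_union_le _ _).trans (add_le_add hbad hdev)))
  simp only [Set.mem_compl_iff, Set.mem_union, Set.mem_ofPred_eq, not_or, not_not, Set.mem_iUnion,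
    not_exists, not_and, not_lt] at hω
  exact isDistortionEmbedding_of_isCover A R hR hε0.le hε.le hτ hs hcov hγ
    fun z hz => hω.2 z hz hω.1

end Distortion

section Bounds

variable {n d : ℕ} (A : Matrix (Fin n) (Fin d) ℝ) (R : Matrix (Fin d) (Fin d) ℝ) {κ ε τ : ℝ}

theorem execute_snd_le_log (κ ε τ : ℝ) (ω : Seed n d (numProj n)) (hd : 0 < d) (hn : 2 ≤ n) :
    ((execute A R κ ε τ ω).2 : ℝ) ≤ 214000 * ((nnz A + (d : ℝ) ^ 2) * Real.log n) := by
  calc ((execute A R κ ε τ ω).2 : ℝ)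
      ≤ 2000 * (numProj n * (nnz A + (d : ℝ) ^ 2)) := by
        exact_mod_cast execute_snd_le (numProj_pos (by lia)) hd
    _ ≤ 2000 * (107 * Real.log n * (nnz A + (d : ℝ) ^ 2)) := by gcongr; exact numProj_le hn
    _ = 214000 * ((nnz A + (d : ℝ) ^ 2) * Real.log n) := by ring

theorem one_sub_exp_le_measureReal_numSampled_le {α β : ℝ} (hd : 0 < d)
    (hU : IsConditioned α β (A * R⁻¹)) (hκ : α * β ≤ κ) (hε0 : 0 < ε) (hε : ε < 1 / 2)
    (hτ : 1 / 2 ≤ τ) (hτ1 : τ < 1) :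
    1 - Real.exp (-(τ / (1 - τ) * κ * d * Real.log (τ / (1 - τ) / ε) / ε ^ 2)) ≤
      (seedLaw n d (numProj n)).real {ω | (numSampled (samplingMatrix A R κ ε τ ω) : ℝ) ≤
        3159 * (τ / (1 - τ) * κ * d * Real.log (τ / (1 - τ) / ε) / ε ^ 2)} := by
  have hκ0 : 0 < κ := by linarith [hU.one_le_mul hd]
  have hs := sampleSize_pos (d := d) hκ0 hε0 hε hτ hτ1
  have hsN := sampleSize_le hd hκ0.le hε0 hε hτ hτ1
  set N := τ / (1 - τ) * κ * d * Real.log (τ / (1 - τ) / ε) / ε ^ 2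
  refine one_sub_le_measureReal_of_compl_subset
    (B := {ω | 3159 * N ≤ numSampled (samplingMatrix A R κ ε τ ω)})
    (fun ω hω => ?_)
    ((seedLaw_real_le_numSampled_le (numProj_pos (hU.card_pos hd)) A R hs.le (3159 * N)).trans
      (Real.exp_le_exp.2 ?_))
  · rw [Set.mem_compl_iff, Set.mem_ofPred_eq, not_le] at hω
    exact hω.le
  · have hlog : 1054 ≤ 3159 * Real.log 2 := by linarith [Real.log_two_gt_d9]
    nlinarith

end Bounds

end QuantileSampling

open QuantileSampling in
theorem proposition3p2_general :
    ∃ C₁ C₂ : ℝ, ∃ δ : ℝ → ℝ, Tendsto δ atTop (𝓝 0) ∧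
      ∀ (n d : ℕ) (A : Matrix (Fin n) (Fin d) ℝ) (R : Matrix (Fin d) (Fin d) ℝ) (α β κ ε τ : ℝ),
        IsUnit R.det → 0 < d → IsConditioned α β (A * R⁻¹) → α * β ≤ κ →
        0 < ε → ε < 1 / 2 → 1 / 2 ≤ τ → τ < 1 →
        (∀ ω : Seed n d (numProj n),
          (execute A R κ ε τ ω).1 = diagonalList (samplingMatrix A R κ ε τ ω) ∧
          (2 ≤ n → ((execute A R κ ε τ ω).2 : ℝ) ≤ C₁ * ((nnz A + (d : ℝ) ^ 2) * Real.log n)) ∧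
          (2 ≤ n → d ^ 2 ≤ nnz A →
            ((execute A R κ ε τ ω).2 : ℝ) ≤ C₁ * (nnz A * Real.log n))) ∧
        0.9 ≤ (seedLaw n d (numProj n)).real
          {ω | IsDistortionEmbedding ε τ A (samplingMatrix A R κ ε τ ω)} ∧
        1 - δ (τ / (1 - τ) * κ * d * Real.log (τ / (1 - τ) / ε) / ε ^ 2) ≤
          (seedLaw n d (numProj n)).real {ω | (numSampled (samplingMatrix A R κ ε τ ω) : ℝ) ≤
            C₂ * (τ / (1 - τ) * κ * d * Real.log (τ / (1 - τ) / ε) / ε ^ 2)} := by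
  refine ⟨428000, 3159, fun N => Real.exp (-N), Real.tendsto_exp_neg_atTop_nhds_zero, ?_⟩
  intro n d A R α β κ ε τ hR hd hU hκ hε0 hε hτ hτ1
  refine ⟨fun ω => ⟨execute_fst (numProj_pos (hU.card_pos hd)), fun hn => ?_,
      fun hn hnnz => ?_⟩,
    le_measureReal_isDistortionEmbedding A R hd hU hκ hε0 hε hτ hτ1 hR,
    one_sub_exp_le_measureReal_numSampled_le A R hd hU hκ hε0 hε hτ hτ1⟩
  · refine (execute_snd_le_log A R κ ε τ ω hd hn).trans ?_
    gcongr
    norm_num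
  · have hd2 : (d : ℝ) ^ 2 ≤ nnz A := by exact_mod_cast hnnz
    calc ((execute A R κ ε τ ω).2 : ℝ)
        ≤ 214000 * ((nnz A + (d : ℝ) ^ 2) * Real.log n) :=
          execute_snd_le_log A R κ ε τ ω hd hn
      _ ≤ 214000 * ((nnz A + nnz A) * Real.log n) := by gcongr
      _ = 428000 * (nnz A * Real.log n) := by ring

theorem proposition3p2 :
    ∃ C₁ C₂ : ℝ, ∃ δ : ℝ → ℝ, Tendsto δ atTop (𝓝 0) ∧
      ∀ (n d : ℕ) (A : Matrix (Fin n) (Fin d) ℝ) (R : Matrix (Fin d) (Fin d) ℝ) (κ ε τ : ℝ),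
        IsUnit R.det → QuantileSampling.IsConditionNumber (A * R⁻¹) κ →
        0 < ε → ε < 1 / 2 → 1 / 2 ≤ τ → τ < 1 →
        -- whatever the random numbers are, the program outputs the sampling matrix,
        -- within the claimed time
        (∀ ω : QuantileSampling.Seed n d (QuantileSampling.numProj n),
          (QuantileSampling.execute A R κ ε τ ω).1 =
            QuantileSampling.diagonalList (QuantileSampling.samplingMatrix A R κ ε τ ω) ∧
          (2 ≤ n → ((QuantileSampling.execute A R κ ε τ ω).2 : ℝ) ≤
            C₁ * ((QuantileSampling.nnz A + (d : ℝ) ^ 2) * Real.log n)) ∧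
          (2 ≤ n → d ^ 2 ≤ QuantileSampling.nnz A →
            ((QuantileSampling.execute A R κ ε τ ω).2 : ℝ) ≤
              C₁ * (QuantileSampling.nnz A * Real.log n))) ∧
        -- the distortion bound
        0.9 ≤ (QuantileSampling.seedLaw n d (QuantileSampling.numProj n)).real
          {ω | QuantileSampling.IsDistortionEmbedding ε τ A
            (QuantileSampling.samplingMatrix A R κ ε τ ω)} ∧
        -- the number of sampled rows
        1 - δ (τ / (1 - τ) * κ * d * Real.log (τ / (1 - τ) / ε) / ε ^ 2) ≤
          (QuantileSampling.seedLaw n d (QuantileSampling.numProj n)).real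
            {ω | (QuantileSampling.numSampled (QuantileSampling.samplingMatrix A R κ ε τ ω) : ℝ) ≤
              C₂ * (τ / (1 - τ) * κ * d * Real.log (τ / (1 - τ) / ε) / ε ^ 2)} := by
  obtain ⟨C₁, C₂, δ, hδ, h⟩ := proposition3p2_general
  refine ⟨C₁, C₂, δ, hδ, fun n d A R κ ε τ hR hU => ?_⟩
  obtain ⟨α, β, hαβ, rfl⟩ := hU.1
  exact h n d A R α β _ ε τ hR hU.dim_pos hαβ le_rfl
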